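/- Let $d\in\{2,3\}$ and let $\Omega\subset\mathbb R^d$ be a bounded domain whose closure is triangulated by a finite simplicial mesh $\mathcal T^m$; let $S^m$ be the space of continuous functions on $\overline\Omega$ that are affine on each element of $\mathcal T^m$. *Cluster.* Let $\Gamma^m=\bigcup_{i=1}^{I_S}\Gamma_i^m\subset\Omega$ be an embedded conforming polyhedral surface cluster: $\Gamma^m_i=\bigcup_{j=1}^{J_i}\overline{\sigma^m_{i,j}}$ with nondegenerate, mutually disjoint open $(d-1)$-simplices with ordered vertices $\vec q^m_{i,j,1},\dots,\vec q^m_{i,j,d}$; any two closed simplices of the cluster meet in the face spanned by their common vertices; and different surfaces share vertices only by matching them at the triple junctions $\mathcal T^m_k$, $k=1,\dots,I_T$, each of which is a set of matched vertices of three surfaces $\Gamma^m_{s^k_1},\Gamma^m_{s^k_2},\Gamma^m_{s^k_3}$. For a simplex $\sigma$ with ordered vertices $\vec q_1,\dots,\vec q_d$ let $\vec N\{\sigma\}=(\vec q_2-\vec q_1)^\perp$ if $d=2$, where $(v_1,v_2)^\perp=(-v_2,v_1)$, and $\vec N\{\sigma\}=(\vec q_2-\vec q_1)\wedge(\vec q_3-\vec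 q_1)$ if $d=3$. The cluster splits $\Omega$ into phases: $\Omega=\Gamma^m\cup\bigcup_{\ell=1}^{I_R}\Omega^m_\ell$ with open sets $\Omega_\ell^m$ that are disjoint from each other and from $\Gamma^m$, and the normals $\vec N\{\sigma^m_{i,j}\}$ point from $\Omega^m_{b_i^-}$ into $\Omega^m_{b_i^+}$. Let $\beta_\ell\in\mathbb R$, $[\beta]_i=\beta_{b^+_i}-\beta_{b^-_i}$, let $\gamma_i>0$ be the surface tensions, and let $t_m<t_{m+1}$, $\tau_m=t_{m+1}-t_m$. *Spaces and inner products.* Let $V^h(\Gamma^m_i)$ be the continuous functions on $\Gamma^m_i$ that are affine on each simplex, $\underline V^h(\Gamma_i^m)$ the corresponding space of $\mathbb R^d$-valued functions, $V^h(\Gamma^m)=\prod_i V^h(\Gamma^m_i)$, and let $\underline V^h(\Gamma^m)$ be the set of $(\vec X_i)_i\in\prod_i\underline V^h(\Gamma^m_i)$ with $\vec X_{s^k_1}=\vec X_{s^k_2}=\vec X_{s^k_3}$ on $\mathcal T^m_k$ for all $k$. Let $\langle u,v\rangle_{\Gamma^m_i}=\int_{\Gamma^m_i}u\cdot v\,d\mathscr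 H^{d-1}$ and let $\langle u,v\rangle^h_{\Gamma^m_i}=\frac1d\sum_j|\sigma^m_{i,j}|\sum_{k=1}^d (u\cdot v)(\vec q^m_{i,j,k})$ be its mass lumped version; without the index $i$, sums over $i$ are meant. Let $\pi^h_i$ be nodal interpolation into $V^h(\Gamma^m_i)$ and $\nabla_s$ the surface gradient. For $\vec X^{m+1}\in\underline V^h(\Gamma^m)$ let $\Gamma^{m+1}=\vec X^{m+1}(\Gamma^m)$, let $\sigma^h_{i,j}(t)$ be the simplex with vertices $\frac{t_{m+1}-t}{\tau_m}\vec q^m_{i,j,k}+\frac{t-t_m}{\tau_m}\vec X^{m+1}_i(\vec q^m_{i,j,k})$, put $$\vec\nu_i^{m+\frac12}\big|_{\sigma^m_{i,j}}=\frac1{\tau_m|\vec N\{\sigma^m_{i,j}\}|}\int_{t_m}^{t_{m+1}}\vec N\{\sigma^h_{i,j}(t)\}\,dt ,$$ and let $\vec\omega_i^{m+\frac12}\in\underline V^h(\Gamma_i^m)$ be given by $\langle\vec\omega_i^{m+\frac12},\vec\xi\rangle^h_{\Gamma^m_i}=\langle\vec\nu_i^{m+\frac12},\vec\xi\rangle_{\Gamma^m_i}$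 for all $\vec\xi\in\underline V^h(\Gamma^m_i)$. *Scheme.* Let $(W^{m+1},\vec X^{m+1},\kappa_\gamma^{m+1})\in S^m\times\underline V^h(\Gamma^m)\times V^h(\Gamma^m)$ satisfy, for all $\varphi\in S^m$, $\xi\in V^h(\Gamma^m)$ and $\vec\eta\in\underline V^h(\Gamma^m)$, $$\int_\Omega\nabla W^{m+1}\cdot\nabla\varphi\,dx+\sum_{i}[\beta]_i\Big\langle\pi^h_i\Big[\tfrac{\vec X_i^{m+1}-\vec{\rm id}}{\tau_m}\cdot\vec\omega_i^{m+\frac12}\Big],\varphi\Big\rangle^{(h)}_{\Gamma_i^m}=0,$$ $$\langle\kappa_\gamma^{m+1},\xi\rangle^h_{\Gamma^m}+\sum_i[\beta]_i\langle W^{m+1},\xi_i\rangle^{(h)}_{\Gamma^m_i}=0,$$ $$\langle\kappa^{m+1}_\gamma\vec\omega^{m+\frac12},\vec\eta\rangle^h_{\Gamma^m}+\langle\gamma\nabla_s\vec X^{m+1},\nabla_s\vec\eta\rangle_{\Gamma^m}=0,$$ where $\langle\cdot,\cdot\rangle^{(h)}$ stands, throughout, either for the mass lumped or for the exact inner product.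 *Claim.* Suppose that $\Gamma^{m+1}$ is again an embedded polyhedral cluster in $\Omega$ in the above sense, with phases $\Omega^{m+1}_\ell$ and the same $b^\pm$, and that near $\partial\Omega$ the phases at the two time levels coincide. Then the discrete total energy content $v^m=\sum_{\ell=1}^{I_R}\beta_\ell|\Omega^m_\ell|$ is conserved exactly: $v^{m+1}=v^m$. -/

import Mathlib

noncomputable section

namespace Stefan

/-- Points of `ℝ^d` with `d = n + 1`, so that `n = d - 1` is the dimension of the interfaces. -/
abbrev Pt (n : ℕ) : Type := EuclideanSpace ℝ (Fin (n + 1))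

/-! ### A single `(d-1)`-simplex, given by its ordered vertices `p 0, …, p n` -/

/-- The (non-normalised) normal `N` of an ordered simplex, characterised by
`N ⬝ v = det (p 1 - p 0, …, p n - p 0, v)`. It equals `(p 1 - p 0)^⊥` for `d = 2` and
`(p 1 - p 0) ∧ (p 2 - p 0)` for `d = 3`, see the two lemmas below. -/
def areaNormal {n : ℕ} (p : Fin (n + 1) → Pt n) : Pt n :=
  WithLp.toLp 2 fun k => Matrix.det (Matrix.of
    (Fin.snoc (α := fun _ => Fin (n + 1) → ℝ) (fun a : Fin n => ⇑(p a.succ - p 0))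
      (Pi.single k 1)))

theorem areaNormal_two (p : Fin 2 → Pt 1) :
    areaNormal p = !₂[-(p 1 - p 0) 1, (p 1 - p 0) 0] := by
  ext k
  fin_cases k <;> simp [areaNormal, Matrix.det_fin_two, Fin.snoc]

theorem areaNormal_three (p : Fin 3 → Pt 2) :
    areaNormal p = WithLp.toLp 2 (crossProduct ⇑(p 1 - p 0) ⇑(p 2 - p 0)) := by
  ext k
  fin_cases k <;>
    simp [areaNormal, Matrix.det_fin_three, Fin.snoc, cross_apply] <;> ring

/-- The `(d-1)`-dimensional measure of the simplex. -/
def simplexArea {n : ℕ} (p : Fin (n + 1) → Pt n) : ℝ := ‖areaNormal p‖ / (n.factorial : ℝ)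

/-- The reference simplex in the parameter space `ℝ^(d-1)`. -/
def refSimplex (n : ℕ) : Set (Fin n → ℝ) := {s | (∀ a, 0 ≤ s a) ∧ ∑ a, s a ≤ 1}

/-- The affine parametrisation of the simplex over the reference simplex. -/
def param {n : ℕ} (p : Fin (n + 1) → Pt n) (s : Fin n → ℝ) : Pt n :=
  p 0 + ∑ a, s a • (p a.succ - p 0)

/-- The surface integral of `f` over the simplex (the area element of `param p` is
`‖areaNormal p‖`). -/
def simplexIntegral {n : ℕ} (p : Fin (n + 1) → Pt n) (f : Pt n → ℝ) : ℝ :=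
  ‖areaNormal p‖ * ∫ s in refSimplex n, f (param p s)

/-- The closed simplex. -/
def closedSimplex {n : ℕ} (p : Fin (n + 1) → Pt n) : Set (Pt n) := convexHull ℝ (Set.range p)

/-- The (relatively) open simplex. -/
def openSimplex {n : ℕ} (p : Fin (n + 1) → Pt n) : Set (Pt n) :=
  {x | ∃ w : Fin (n + 1) → ℝ, (∀ a, 0 < w a) ∧ ∑ a, w a = 1 ∧ x = ∑ a, w a • p a}

/-- The pointwise product `∇ₛ f : ∇ₛ g` of the surface gradients of two vector fields on the
simplex, i.e. the sum over an orthonormal basis of the tangent space of the products of the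
tangential derivatives. -/
def surfGradInner {n : ℕ} (p : Fin (n + 1) → Pt n) (f g : Pt n → Pt n) (x : Pt n) : ℝ :=
  ∑ a, inner ℝ
    (fderivWithin ℝ f (closedSimplex p) x
      (stdOrthonormalBasis ℝ (vectorSpan ℝ (Set.range p)) a : Pt n))
    (fderivWithin ℝ g (closedSimplex p) x
      (stdOrthonormalBasis ℝ (vectorSpan ℝ (Set.range p)) a : Pt n))

/-- The time-averaged normal on the simplex `p` when its vertices move linearly from `p` to `p'`
during `[t₀, t₁]`: `(τ |N(p)|)⁻¹ ∫_{t₀}^{t₁} N(p(t)) dt`, `τ = t₁ - t₀`. -/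
def midNormal {n : ℕ} (t₀ t₁ : ℝ) (p p' : Fin (n + 1) → Pt n) : Pt n :=
  (1 / ((t₁ - t₀) * ‖areaNormal p‖)) •
    ∫ t in t₀..t₁, areaNormal fun a =>
      ((t₁ - t) / (t₁ - t₀)) • p a + ((t - t₀) / (t₁ - t₀)) • p' a

/-! ### Surface clusters -/

/-- The time-independent combinatorial data of a discrete surface cluster: the triangulated
reference surfaces, the phases on their two sides, and the triple junctions. -/
structure ClusterMesh (n : ℕ) where
  /-- the number of surfaces -/
  numSurf : ℕ
  /-- the number of phases -/
  numPhase : ℕ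
  /-- the number of triple junctions -/
  numJunc : ℕ
  /-- the number of vertices of each surface -/
  numVert : Fin numSurf → ℕ
  /-- the number of simplices of each surface -/
  numSimp : Fin numSurf → ℕ
  /-- the ordered vertices of each simplex -/
  simp : ∀ i, Fin (numSimp i) → Fin (n + 1) → Fin (numVert i)
  /-- every vertex is a vertex of some simplex -/
  vertex_used : ∀ i k, ∃ j a, simp i j a = k
  /-- the phase into which the normal of a surface points -/
  plus : Fin numSurf → Fin numPhase
  /-- the phase out of which the normal of a surface points -/
  minus : Fin numSurf → Fin numPhase
  /-- the three surfaces that meet at a triple junction -/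
  juncSurf : Fin numJunc → Fin 3 → Fin numSurf
  juncSurf_strictMono : ∀ k, StrictMono (juncSurf k)
  /-- the number of vertices on a triple junction -/
  numJuncVert : Fin numJunc → ℕ
  /-- the enumeration, for each of the three surfaces, of its vertices on the junction -/
  juncVert : ∀ k r, Fin (numJuncVert k) → Fin (numVert (juncSurf k r))
  juncVert_injective : ∀ k r, Function.Injective (juncVert k r)

namespace ClusterMesh

variable {n : ℕ} (M : ClusterMesh n)

/-- Positions of all the vertices of all the surfaces. -/
abbrev Config : Type := ∀ i, Fin (M.numVert i) → Pt n

/-- The ordered vertices of the `j`-th simplex of the `i`-th surface. -/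
def corners (q : M.Config) (i : Fin M.numSurf) (j : Fin (M.numSimp i)) : Fin (n + 1) → Pt n :=
  fun a => q i (M.simp i j a)

/-- The polyhedral surface `Γ_i`. -/
def surface (q : M.Config) (i : Fin M.numSurf) : Set (Pt n) :=
  ⋃ j, closedSimplex (M.corners q i j)

/-- The cluster `Γ = ⋃ Γ_i`. -/
def cluster (q : M.Config) : Set (Pt n) := ⋃ i, M.surface q i

/-- The vertices of the `k`-th triple junction. -/
def junction (q : M.Config) (k : Fin M.numJunc) : Set (Pt n) :=
  Set.range fun z => q (M.juncSurf k 0) (M.juncVert k 0 z)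

/-- Two vertices of surfaces that correspond to each other at a triple junction. -/
def Matched (u v : Σ i, Fin (M.numVert i)) : Prop :=
  ∃ k r r' z, u = ⟨M.juncSurf k r, M.juncVert k r z⟩ ∧ v = ⟨M.juncSurf k r', M.juncVert k r' z⟩

/-- The vertex positions `q` define an embedded polyhedral surface cluster inside the domain `Ω`,
which splits `Ω` into the phases `Ph ℓ`; the normals of the `i`-th surface point from the phase
`minus i` into the phase `plus i`. -/
structure IsCluster (Ω : Set (Pt n)) (q : M.Config) (Ph : Fin M.numPhase → Set (Pt n)) :
    Prop where
  /-- the simplices are nondegenerate -/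
  nondegenerate : ∀ i j, AffineIndependent ℝ (M.corners q i j)
  /-- the vertices match up at the triple junctions, and distinct vertices are not in the same
  place otherwise -/
  vertex_eq_iff : ∀ u v : Σ i, Fin (M.numVert i),
    q u.1 u.2 = q v.1 v.2 ↔ Relation.EqvGen M.Matched u v
  /-- distinct open simplices are disjoint -/
  open_disjoint : ∀ i j i' j', (⟨i, j⟩ : Σ i, Fin (M.numSimp i)) ≠ ⟨i', j'⟩ →
    Disjoint (openSimplex (M.corners q i j)) (openSimplex (M.corners q i' j'))
  /-- two closed simplices meet in the face that is spanned by their common vertices -/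
  conforming : ∀ i j i' j',
    closedSimplex (M.corners q i j) ∩ closedSimplex (M.corners q i' j') =
      convexHull ℝ (Set.range (M.corners q i j) ∩ Set.range (M.corners q i' j'))
  /-- the cluster lies inside the domain -/
  subset_domain : M.cluster q ⊆ Ω
  phase_open : ∀ ℓ, IsOpen (Ph ℓ)
  phase_disjoint : Pairwise fun ℓ ℓ' => Disjoint (Ph ℓ) (Ph ℓ')
  phase_disjoint_cluster : ∀ ℓ, Disjoint (Ph ℓ) (M.cluster q)
  /-- the cluster and the phases make up the domain -/
  domain_eq : Ω = M.cluster q ∪ ⋃ ℓ, Ph ℓ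
  /-- the normals point from the phase `minus i` into the phase `plus i` -/
  normal_side : ∀ i j, ∀ x ∈ openSimplex (M.corners q i j), ∀ᶠ ε : ℝ in nhdsWithin 0 (Set.Ioi 0),
    x + ε • areaNormal (M.corners q i j) ∈ Ph (M.plus i) ∧
      x - ε • areaNormal (M.corners q i j) ∈ Ph (M.minus i)

/-- The total energy content `∑ β_ℓ |Ω_ℓ|`. -/
def energyContent (β : Fin M.numPhase → ℝ) (Ph : Fin M.numPhase → Set (Pt n)) : ℝ :=
  ∑ ℓ, β ℓ * (MeasureTheory.volume (Ph ℓ)).toReal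

/-- The jump of `β` across the `i`-th surface, from the phase `minus i` to the phase `plus i`. -/
def jump (β : Fin M.numPhase → ℝ) (i : Fin M.numSurf) : ℝ := β (M.plus i) - β (M.minus i)

/-! ### Finite element spaces

Functions on `Γ_i` or on the closure of `Ω` are represented by functions on `ℝ^d`, of which only
the values on that set are used. -/

/-- Membership in the space of continuous piecewise affine functions on `Γ_i` (scalar for
`F = ℝ`, vector valued for `F = ℝ^d`). -/
def InSurf {F : Type} [NormedAddCommGroup F] [NormedSpace ℝ F] (q : M.Config)
    (i : Fin M.numSurf) (v : Pt n → F) : Prop :=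
  ContinuousOn v (M.surface q i) ∧
    ∀ j, ∃ A : Pt n →ᵃ[ℝ] F, Set.EqOn v A (closedSimplex (M.corners q i j))

/-- Membership in the space of families of continuous piecewise affine vector fields on the
surfaces that coincide at the triple junctions. -/
def InCluster (q : M.Config) (X : Fin M.numSurf → Pt n → Pt n) : Prop :=
  (∀ i, M.InSurf q i (X i)) ∧
    ∀ k, ∀ x ∈ M.junction q k,
      X (M.juncSurf k 0) x = X (M.juncSurf k 1) x ∧ X (M.juncSurf k 1) x = X (M.juncSurf k 2) x

/-- The vertex positions of the image `X(Γ)` of the cluster. -/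
def moved (q : M.Config) (X : Fin M.numSurf → Pt n → Pt n) : M.Config :=
  fun i k => X i (q i k)

/-- Integral over `Γ_i`. -/
def surfIntegral (q : M.Config) (i : Fin M.numSurf) (f : Pt n → ℝ) : ℝ :=
  ∑ j, simplexIntegral (M.corners q i j) f

/-- Mass lumped integral over `Γ_i`: the vertex quadrature rule, for functions that are continuous
on `Γ_i`. The mass lumped inner product of `u` and `v` is the mass lumped integral of `u v`. -/
def lumpedIntegral (q : M.Config) (i : Fin M.numSurf) (f : Pt n → ℝ) : ℝ :=
  1 / ((n : ℝ) + 1) * ∑ j, simplexArea (M.corners q i j) * ∑ a, f (M.corners q i j a)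

/-- Integral over `Γ_i` with (`lumped = true`) or without (`lumped = false`) mass lumping. -/
def quadIntegral (lumped : Bool) (q : M.Config) (i : Fin M.numSurf) (f : Pt n → ℝ) : ℝ :=
  if lumped then M.lumpedIntegral q i f else M.surfIntegral q i f

/-- `g` is the piecewise affine nodal interpolant of `f` on `Γ_i`. -/
def IsInterpolant (q : M.Config) (i : Fin M.numSurf) (f g : Pt n → ℝ) : Prop :=
  M.InSurf q i g ∧ ∀ k, g (q i k) = f (q i k)

/-- `ω` is the time-averaged vertex normal on `Γ_i` for the motion from `q` to `q'` during
`[t₀, t₁]`: the mass lumped `L²` projection of the piecewise constant time-averaged normal. -/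
def IsMidVertexNormal (t₀ t₁ : ℝ) (q q' : M.Config) (i : Fin M.numSurf)
    (ω : Pt n → Pt n) : Prop :=
  M.InSurf q i ω ∧ ∀ ξ : Pt n → Pt n, M.InSurf q i ξ →
    M.lumpedIntegral q i (fun x => inner ℝ (ω x) (ξ x)) =
      ∑ j, simplexIntegral (M.corners q i j)
        (fun x => inner ℝ (midNormal t₀ t₁ (M.corners q i j) (M.corners q' i j)) (ξ x))

end ClusterMesh

/-- `T` is a (finite) triangulation of the closure of `Ω`. -/
def IsTriangulation {n : ℕ} (Ω : Set (Pt n)) (T : Geometry.SimplicialComplex ℝ (Pt n)) : Prop :=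
  T.faces.Finite ∧ T.space = closure Ω

/-- Membership in the space of continuous functions on the closure of `Ω` that are affine on each
simplex of the bulk mesh `T`. -/
def InBulk {n : ℕ} (Ω : Set (Pt n)) (T : Geometry.SimplicialComplex ℝ (Pt n))
    (v : Pt n → ℝ) : Prop :=
  ContinuousOn v (closure Ω) ∧
    ∀ o ∈ T.faces, ∃ A : Pt n →ᵃ[ℝ] ℝ, Set.EqOn v A (convexHull ℝ (o : Set (Pt n)))

/-- `(W, X, κ)` solves the nonlinear structure-preserving scheme on the time interval `[t₀, t₁]`,
given the cluster with vertices `q`. Here `ω` is the time-averaged vertex normal (which depends on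
`X`) and `g i` is the interpolant of `((X_i - id) / τ) ⬝ ω_i`; both are determined on `Γ_i`. -/
structure IsSolution {n : ℕ} (M : ClusterMesh n) (Ω : Set (Pt n))
    (T : Geometry.SimplicialComplex ℝ (Pt n)) (β : Fin M.numPhase → ℝ) (tension : Fin M.numSurf → ℝ)
    (lumped : Bool) (t₀ t₁ : ℝ) (q : M.Config)
    (W : Pt n → ℝ) (X : Fin M.numSurf → Pt n → Pt n) (κ : Fin M.numSurf → Pt n → ℝ) : Prop where
  mem_bulk : InBulk Ω T W
  mem_cluster : M.InCluster q X
  mem_surf : ∀ i, M.InSurf q i (κ i)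
  equations : ∃ (ω : Fin M.numSurf → Pt n → Pt n) (g : Fin M.numSurf → Pt n → ℝ),
    (∀ i, M.IsMidVertexNormal t₀ t₁ q (M.moved q X) i (ω i)) ∧
    (∀ i, M.IsInterpolant q i
      (fun x => inner ℝ ((1 / (t₁ - t₀)) • (X i x - x)) (ω i x)) (g i)) ∧
    -- motion law
    (∀ φ, InBulk Ω T φ →
      (∫ x in Ω, inner ℝ (gradient W x) (gradient φ x)) +
        ∑ i, M.jump β i * M.quadIntegral lumped q i (fun x => g i x * φ x) = 0) ∧
    -- Gibbs–Thomson law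
    (∀ ξ : Fin M.numSurf → Pt n → ℝ, (∀ i, M.InSurf q i (ξ i)) →
      ∑ i, M.lumpedIntegral q i (fun x => κ i x * ξ i x) +
        ∑ i, M.jump β i * M.quadIntegral lumped q i (fun x => W x * ξ i x) = 0) ∧
    -- curvature vector
    (∀ η : Fin M.numSurf → Pt n → Pt n, M.InCluster q η →
      ∑ i, M.lumpedIntegral q i (fun x => inner ℝ (κ i x • ω i x) (η i x)) +
        ∑ i, ∑ j, simplexIntegral (M.corners q i j)
          (fun x => tension i * surfGradInner (M.corners q i j) (X i) (η i) x) = 0)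

end Stefan

end

noncomputable section

namespace Stefan

/-! ### Determinants of simplices -/

/-! Write d = n + 1, call the simplices of the cluster cells, and let D be the sum over all cells of
the jump of β times `vecDet`, the determinant of the vertices. Up to sign, `vecDet` is d! times the
volume of the cone with apex 0 over the cell. The proof shows that D controls the energy content and
that the scheme preserves D.

Energy and D (`energyContent_sub`). Follow the ray from a generic point x to infinity. Whenever it
crosses a cell, the function with value β ℓ on the phase ℓ changes by the jump times the sign of the
crossing, and the cells that are crossed are those whose cone contains x. At ∂Ω a single phase
function is not controlled, but the difference of the old and the new one vanishes there.
Integration over x shows that the change of the energy content is a fixed multiple of D(old) -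
D(new). No apex inside Ω and no star-shapedness is involved.

Motion of D (`sum_vecDet_eq_of_flux`). Let the vertices move linearly. Up to a constant factor, the
derivative of D is the weighted sum of the products of the cell normals with the vertex
displacements, up to terms that are alternating functions of the facets (`sum_inner_areaNormal`).
These terms cancel, because the cells weighted by the jumps form a cycle (`sum_jump_mul_facetSign`):
once around a small circle about a facet, the phase function returns to its value, so the signed
jumps met on the way add up to zero. Only the old cluster is used for this; facets shared at the old
time level stay shared by `exists_vertexMotion`. Intermediate configurations need not be embedded.

Scheme (`flux_eq_zero`). Testing the motion law with 1 leaves the integrals of the interpolants. On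
piecewise affine functions both quadratures agree up to a nonzero constant, and the definition of ω
turns the integrals into products of displacements with time integrals of the normals. Hence the
flux in the formula for the derivative of D integrates to zero over the time step. -/

/-- The determinant of `d` vectors of `ℝ^d`. -/
def vecDet (n : ℕ) : (Pt n) [⋀^Fin (n + 1)]→ₗ[ℝ] ℝ :=
  Matrix.detRowAlternating.compLinearMap (WithLp.linearEquiv 2 ℝ (Fin (n + 1) → ℝ)).toLinearMap

/-- Homogeneous coordinates. -/
def homCoord (n : ℕ) : ℝ × Pt n →ₗ[ℝ] (Fin (n + 2) → ℝ) where
  toFun y := Fin.cons y.1 (fun k => y.2 k)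
  map_add' y z := by
    ext k; refine Fin.cases ?_ (fun k => ?_) k <;> simp
  map_smul' c y := by
    ext k; refine Fin.cases ?_ (fun k => ?_) k <;> simp

/-- The determinant in homogeneous coordinates. -/
def homDet (n : ℕ) : (ℝ × Pt n) [⋀^Fin (n + 2)]→ₗ[ℝ] ℝ :=
  Matrix.detRowAlternating.compLinearMap (homCoord n)

theorem vecDet_apply {n : ℕ} (p : Fin (n + 1) → Pt n) :
    vecDet n p = Matrix.det (Matrix.of fun a k => p a k) := rfl

theorem homDet_apply {n : ℕ} (y : Fin (n + 2) → ℝ × Pt n) :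
    homDet n y = Matrix.det (Matrix.of fun a => homCoord n (y a)) := rfl

theorem vecDet_update {n : ℕ} (p : Fin (n + 1) → Pt n) (a : Fin (n + 1)) (v : Pt n) :
    vecDet n (Function.update p a v) =
      (-1) ^ (a : ℕ) * vecDet n (Matrix.vecCons v (p ∘ a.succAbove)) := by
  have h := (vecDet n).map_insertNth a v (p ∘ a.succAbove)
  have h' : Function.update p a v = a.insertNth v (p ∘ a.succAbove) := by
    rw [← Fin.insertNth_removeNth]; rfl
  rw [h', h]
  simp

/-- Laplace expansion along the column of weights: the weight is 0 for the direction v and 1 for the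
vertices, and each remaining minor is v together with all vertices but one. -/
theorem homDet_eq_neg_sum {n : ℕ} (p : Fin (n + 1) → Pt n) (v : Pt n) :
    homDet n (Matrix.vecCons (0, v) fun a => (1, p a)) =
      -∑ a, vecDet n (Function.update p a v) := by
  rw [homDet_apply, Matrix.det_succ_column_zero, Fin.sum_univ_succ, ← Finset.sum_neg_distrib]
  have h0 : (Matrix.of fun a => homCoord n
      (Matrix.vecCons ((0 : ℝ), v) (fun a => ((1 : ℝ), p a)) a)) 0 0 = 0 := by
    simp [homCoord]
  rw [h0, mul_zero, zero_mul, zero_add]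
  refine Finset.sum_congr rfl fun a _ => ?_
  rw [vecDet_update, vecDet_apply]
  have h1 : (Matrix.of fun a => homCoord n
      (Matrix.vecCons ((0 : ℝ), v) (fun a => ((1 : ℝ), p a)) a)) a.succ 0 = 1 := by
    simp [homCoord]
  rw [h1, mul_one, Fin.val_succ, pow_succ, mul_neg_one, neg_mul]
  congr 3
  ext b k
  refine Fin.cases ?_ (fun b => ?_) b <;> simp [homCoord]

theorem inner_areaNormal_eq_det {n : ℕ} (p : Fin (n + 1) → Pt n) (v : Pt n) :
    inner ℝ (areaNormal p) v = vecDet n (Fin.snoc (α := fun _ => Pt n)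
      (fun a : Fin n => p a.succ - p 0) v) := by
  have key : ∀ w : Pt n, vecDet n (Fin.snoc (α := fun _ => Pt n)
      (fun a : Fin n => p a.succ - p 0) w) = (vecDet n).toMultilinearMap.toLinearMap
        (Fin.snoc (α := fun _ => Pt n) (fun a : Fin n => p a.succ - p 0) 0) (Fin.last n) w := by
    intro w
    simp [MultilinearMap.toLinearMap, Fin.update_snoc_last]
  have hv : v = ∑ k, v k • EuclideanSpace.single k (1 : ℝ) := by
    ext l
    simp [Pi.single_apply]
  rw [key]
  conv_rhs => rw [hv]
  rw [map_sum, PiLp.inner_apply]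
  refine Finset.sum_congr rfl fun k _ => ?_
  rw [map_smul, ← key, vecDet_apply]
  simp only [areaNormal, RCLike.inner_apply, conj_trivial, smul_eq_mul]
  congr 3
  ext a l
  refine Fin.lastCases ?_ (fun a => ?_) a <;> simp [Pi.single_apply]

/-- `areaNormal` singles out the vertex p 0. Subtracting the row of p 0 from the other vertex rows
leads to homogeneous coordinates, where all vertices play the same role and permutations only cost a
sign. -/
theorem inner_areaNormal_eq_homDet {n : ℕ} (p : Fin (n + 1) → Pt n) (v : Pt n) :
    inner ℝ (areaNormal p) v =
      (-1) ^ (n + 1) * homDet n (Matrix.vecCons (0, v) fun a => (1, p a)) := by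
  have h1 : homDet n (Matrix.vecCons (0, v) fun a => (1, p a)) =
      homDet n (Matrix.vecCons (0, v) (Matrix.vecCons (1, p 0) fun a => (0, p a.succ - p 0))) := by
    rw [homDet_apply, homDet_apply]
    refine Matrix.det_eq_of_forall_row_eq_smul_add_const
      (Matrix.vecCons 0 (Matrix.vecCons 0 fun _ => 1)) 1 (by simp) fun a k => ?_
    refine Fin.cases (by simp) (fun a => Fin.cases (by simp) (fun a => ?_) a) a
    refine Fin.cases ?_ (fun k => ?_) k <;> simp [homCoord]
  have h2 : homDet n
      (Matrix.vecCons (0, v) (Matrix.vecCons (1, p 0) fun a => (0, p a.succ - p 0))) =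
        -vecDet n (Matrix.vecCons v fun a => p a.succ - p 0) := by
    rw [homDet_apply, Matrix.det_succ_column_zero, Fin.sum_univ_succ, Fin.sum_univ_succ,
      Finset.sum_eq_zero, vecDet_apply]
    · simp [homCoord]
      congr 1
      ext b k
      refine Fin.cases ?_ (fun b => ?_) b
      · simp
      · simp only [Matrix.submatrix_apply, Matrix.of_apply]
        have : Fin.succAbove (1 : Fin (n + 2)) b.succ = b.succ.succ := by
          simp [Fin.succAbove, Fin.lt_def]
        rw [this]; simp
    · intro a _
      simp [homCoord]
  rw [inner_areaNormal_eq_det, ← Fin.insertNth_last', (vecDet n).map_insertNth, h1, h2]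
  simp [pow_succ]

/-- The right-hand side is, up to sign, the derivative of the determinant when all vertices move
with the same velocity v. This ties the normal to the cone volume. -/
theorem inner_areaNormal_eq_sum {n : ℕ} (p : Fin (n + 1) → Pt n) (v : Pt n) :
    inner ℝ (areaNormal p) v = (-1) ^ n * ∑ a, vecDet n (Function.update p a v) := by
  rw [inner_areaNormal_eq_homDet, homDet_eq_neg_sum]
  ring

/-- All terms of `inner_areaNormal_eq_sum` but one have a repeated row. -/
theorem inner_areaNormal_vertex {n : ℕ} (p : Fin (n + 1) → Pt n) (a : Fin (n + 1)) :
    inner ℝ (areaNormal p) (p a) = (-1) ^ n * vecDet n p := by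
  rw [inner_areaNormal_eq_sum, Finset.sum_eq_single a]
  · simp
  · intro b _ hb
    refine (vecDet n).map_eq_zero_of_eq _ ?_ hb
    simp [hb.symm]
  · simp

theorem inner_areaNormal_sum {n : ℕ} (p : Fin (n + 1) → Pt n) (w : Fin (n + 1) → ℝ) :
    inner ℝ (areaNormal p) (∑ a, w a • p a) = (∑ a, w a) * ((-1) ^ n * vecDet n p) := by
  simp only [inner_sum, inner_smul_right, inner_areaNormal_vertex, Finset.sum_mul]

/-- A direction that is not tangential to a nondegenerate simplex has a normal component. -/
theorem inner_areaNormal_ne_zero {n : ℕ} {p : Fin (n + 1) → Pt n} (hp : AffineIndependent ℝ p)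
    {v : Pt n} (hv : v ∉ vectorSpan ℝ (Set.range p)) : inner ℝ (areaNormal p) v ≠ 0 := by
  rw [inner_areaNormal_eq_det, vecDet_apply]
  have hli : LinearIndependent ℝ (Fin.snoc (α := fun _ => Pt n)
      (fun a : Fin n => p a.succ - p 0) v) := by
    rw [Fin.snoc_eq_cons_rotate]
    refine (LinearIndependent.comp (linearIndependent_finCons.2 ⟨?_, ?_⟩) _
      (finRotate _).injective)
    · have := (affineIndependent_iff_linearIndependent_vsub ℝ p 0).1 hp
      exact this.comp (fun a : Fin n => ⟨a.succ, Fin.succ_ne_zero a⟩)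
        fun a b h => Fin.succ_injective _ (congrArg Subtype.val h)
    · intro h
      refine hv (Submodule.span_le.2 ?_ h)
      rintro _ ⟨a, rfl⟩
      exact vsub_mem_vectorSpan ℝ (Set.mem_range_self _) (Set.mem_range_self _)
  have := hli.map' (WithLp.linearEquiv 2 ℝ (Fin (n + 1) → ℝ)).toLinearMap (LinearEquiv.ker _)
  have h2 := (Matrix.linearIndependent_rows_iff_isUnit (A := Matrix.of fun a k =>
    Fin.snoc (α := fun _ => Pt n) (fun a : Fin n => p a.succ - p 0) v a k)).1 this
  exact ((Matrix.isUnit_iff_isUnit_det _).1 h2).ne_zero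

theorem areaNormal_ne_zero {n : ℕ} {p : Fin (n + 1) → Pt n} (hp : AffineIndependent ℝ p) :
    areaNormal p ≠ 0 := by
  have hne : vectorSpan ℝ (Set.range p) ≠ ⊤ := by
    intro h
    have h1 := hp.finrank_vectorSpan (n := n) (by simp)
    rw [h, finrank_top] at h1
    simp at h1
  obtain ⟨v, hv⟩ : ∃ v, v ∉ vectorSpan ℝ (Set.range p) := by
    by_contra! h
    exact hne (eq_top_iff.2 fun v _ => h v)
  intro h
  exact inner_areaNormal_ne_zero hp hv (by rw [h, inner_zero_left])

end Stefan

end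

/-! ### Local constants on the real line. -/

noncomputable section

namespace Stefan

open Filter Topology

/-- A function on the line that is constant on a punctured neighbourhood of every point takes the
same constant near every point. -/
theorem exists_eventually_eq_of_punctured {h : ℝ → ℝ}
    (H : ∀ t, ∃ k, ∀ᶠ s in 𝓝[≠] t, h s = k) : ∃ K, ∀ t, ∀ᶠ s in 𝓝[≠] t, h s = K := by
  choose k hk using H
  -- For s near t, s ≠ t, the function h equals k t on a full neighbourhood of s, so k s = k t. The
  -- line is connected.
  have hloc : IsLocallyConstant k := by
    rw [IsLocallyConstant.iff_eventually_eq]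
    intro t
    have h1 : ∀ᶠ s in 𝓝[≠] t, k s = k t := by
      filter_upwards [eventually_eventually_nhdsWithin.2 (hk t), self_mem_nhdsWithin] with s hs hst
      have h2 : ∀ᶠ r in 𝓝 s, h r = k t := by
        rwa [(isOpen_compl_singleton).nhdsWithin_eq hst] at hs
      obtain ⟨r, hr, hr'⟩ := ((hk s).and (h2.filter_mono nhdsWithin_le_nhds)).exists
      rw [← hr, hr']
    rw [eventually_nhdsWithin_iff] at h1
    filter_upwards [h1] with s hs
    by_cases hst : s = t
    · rw [hst]
    · exact hs hst
  refine ⟨k 0, fun t => ?_⟩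
  rw [← hloc.apply_eq_of_preconnectedSpace t 0]
  exact hk t

/-! ### Barycentric coordinates -/

theorem exists_weights_of_mem_convexHull_image {n : ℕ} {p : Fin (n + 1) → Pt n}
    {S : Set (Fin (n + 1))} {x : Pt n} (hx : x ∈ convexHull ℝ (p '' S)) :
    ∃ w : Fin (n + 1) → ℝ, (∀ a, 0 ≤ w a) ∧ ∑ a, w a = 1 ∧ (∀ a ∉ S, w a = 0) ∧
      x = ∑ a, w a • p a := by
  classical
  have hconv : Convex ℝ {x : Pt n | ∃ w : Fin (n + 1) → ℝ, (∀ a, 0 ≤ w a) ∧ ∑ a, w a = 1 ∧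
      (∀ a ∉ S, w a = 0) ∧ x = ∑ a, w a • p a} := by
    rintro _ ⟨w, hw0, hw1, hwS, rfl⟩ _ ⟨z, hz0, hz1, hzS, rfl⟩ s t hs ht hst
    refine ⟨fun a => s * w a + t * z a, fun a => ?_, ?_, fun a ha => ?_, ?_⟩
    · have := hw0 a; have := hz0 a; positivity
    · rw [Finset.sum_add_distrib, ← Finset.mul_sum, ← Finset.mul_sum, hw1, hz1]; simpa using hst
    · simp [hwS a ha, hzS a ha]
    · simp [add_smul, Finset.sum_add_distrib, Finset.smul_sum, smul_smul]
  refine convexHull_min ?_ hconv hx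
  rintro _ ⟨a, ha, rfl⟩
  refine ⟨Pi.single a 1, fun b => ?_, by simp, fun b hb => ?_, ?_⟩
  · rw [Pi.single_apply]; split_ifs <;> norm_num
  · rw [Pi.single_apply, if_neg]; rintro rfl; exact hb ha
  · simp [Pi.single_apply, ite_smul]

theorem mem_closedSimplex_iff {n : ℕ} {p : Fin (n + 1) → Pt n} {x : Pt n} :
    x ∈ closedSimplex p ↔
      ∃ w : Fin (n + 1) → ℝ, (∀ a, 0 ≤ w a) ∧ ∑ a, w a = 1 ∧ x = ∑ a, w a • p a := by
  constructor
  · intro hx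
    rw [closedSimplex, ← Set.image_univ] at hx
    obtain ⟨w, h0, h1, -, h⟩ := exists_weights_of_mem_convexHull_image hx
    exact ⟨w, h0, h1, h⟩
  · rintro ⟨w, h0, h1, rfl⟩
    exact (convex_convexHull ℝ _).sum_mem (fun a _ => h0 a) h1
      fun a _ => subset_convexHull ℝ _ (Set.mem_range_self a)

theorem openSimplex_subset_closedSimplex {n : ℕ} (p : Fin (n + 1) → Pt n) :
    openSimplex p ⊆ closedSimplex p := by
  rintro x ⟨w, h0, h1, h⟩
  exact mem_closedSimplex_iff.2 ⟨w, fun a => (h0 a).le, h1, h⟩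

theorem isClosed_closedSimplex {n : ℕ} (p : Fin (n + 1) → Pt n) : IsClosed (closedSimplex p) :=
  (Set.finite_range p).isClosed_convexHull ℝ

theorem weights_unique {n m : ℕ} {p : Fin m → Pt n} (hp : AffineIndependent ℝ p)
    {w z : Fin m → ℝ} (h1 : ∑ a, w a = ∑ a, z a)
    (h : ∑ a, w a • p a = ∑ a, z a • p a) : w = z := by
  ext a
  have := affineIndependent_iff.1 hp Finset.univ (fun a => w a - z a)
    (by rw [Finset.sum_sub_distrib, h1, sub_self])
    (by simp only [sub_smul, Finset.sum_sub_distrib, h, sub_self]) a (Finset.mem_univ a)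
  exact sub_eq_zero.1 this

theorem inner_areaNormal_sub_of_mem {n : ℕ} {p : Fin (n + 1) → Pt n} {x y : Pt n}
    (hx : x ∈ closedSimplex p) (hy : y ∈ closedSimplex p) :
    inner ℝ (areaNormal p) (x - y) = 0 := by
  obtain ⟨w, -, hw, rfl⟩ := mem_closedSimplex_iff.1 hx
  obtain ⟨z, -, hz, rfl⟩ := mem_closedSimplex_iff.1 hy
  rw [inner_sub_right, inner_areaNormal_sum, inner_areaNormal_sum, hw, hz, sub_self]

theorem inner_areaNormal_of_mem {n : ℕ} {p : Fin (n + 1) → Pt n} {x : Pt n}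
    (hx : x ∈ closedSimplex p) : inner ℝ (areaNormal p) x = (-1) ^ n * vecDet n p := by
  obtain ⟨w, -, hw, rfl⟩ := mem_closedSimplex_iff.1 hx
  rw [inner_areaNormal_sum, hw, one_mul]

/-- A face of a nondegenerate simplex that contains a point with positive barycentric coordinate at
a vertex contains that vertex. -/
theorem mem_of_mem_convexHull_of_pos {n : ℕ} {p : Fin (n + 1) → Pt n}
    (hp : AffineIndependent ℝ p) {A : Set (Pt n)} (hA : A ⊆ Set.range p)
    {w : Fin (n + 1) → ℝ} (hw : ∑ a, w a = 1) (hx : ∑ a, w a • p a ∈ convexHull ℝ A)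
    {a : Fin (n + 1)} (ha : w a ≠ 0) : p a ∈ A := by
  by_contra hpa
  have hsub : A ⊆ p '' {b | p b ∈ A} := fun y hy => by
    obtain ⟨b, rfl⟩ := hA hy
    exact ⟨b, hy, rfl⟩
  obtain ⟨z, -, hz1, hzS, hz⟩ := exists_weights_of_mem_convexHull_image (convexHull_mono hsub hx)
  have := weights_unique hp (hw.trans hz1.symm) hz
  exact ha (by rw [this]; exact hzS a hpa)

/-! ### Phases near a simplex -/

namespace ClusterMesh

variable {n : ℕ} (M : ClusterMesh n)

/-- The simplices of all the surfaces. -/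
abbrev Cell : Type := Σ i, Fin (M.numSimp i)

/-- The ordered vertices of a simplex of the cluster. -/
def cell (q : M.Config) (c : M.Cell) : Fin (n + 1) → Pt n := M.corners q c.1 c.2

/-- The piecewise constant function with value `β ℓ` on the phase `Ph ℓ`. -/
def phaseFun (β : Fin M.numPhase → ℝ) (Ph : Fin M.numPhase → Set (Pt n)) (x : Pt n) : ℝ :=
  ∑ ℓ, (Ph ℓ).indicator (fun _ => β ℓ) x

variable {M} {Ω : Set (Pt n)} {q : M.Config} {Ph : Fin M.numPhase → Set (Pt n)}

theorem closedSimplex_subset_cluster (q : M.Config) (c : M.Cell) :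
    closedSimplex (M.cell q c) ⊆ M.cluster q := fun _ hx =>
  Set.mem_iUnion.2 ⟨c.1, Set.mem_iUnion.2 ⟨c.2, hx⟩⟩

theorem exists_of_mem_cluster {x : Pt n} (hx : x ∈ M.cluster q) :
    ∃ c : M.Cell, x ∈ closedSimplex (M.cell q c) := by
  obtain ⟨i, hx⟩ := Set.mem_iUnion.1 hx
  obtain ⟨j, hx⟩ := Set.mem_iUnion.1 hx
  exact ⟨⟨i, j⟩, hx⟩

namespace IsCluster

theorem affineIndependent (h : M.IsCluster Ω q Ph) (c : M.Cell) :
    AffineIndependent ℝ (M.cell q c) := h.nondegenerate c.1 c.2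

theorem phase_subset (h : M.IsCluster Ω q Ph) (ℓ : Fin M.numPhase) : Ph ℓ ⊆ Ω := by
  rw [h.domain_eq]
  exact (Set.subset_iUnion Ph ℓ).trans Set.subset_union_right

theorem phaseFun_of_mem (h : M.IsCluster Ω q Ph) (β : Fin M.numPhase → ℝ) {ℓ : Fin M.numPhase}
    {x : Pt n} (hx : x ∈ Ph ℓ) : M.phaseFun β Ph x = β ℓ := by
  rw [phaseFun, Finset.sum_eq_single ℓ]
  · simp [hx]
  · intro m _ hm
    exact Set.indicator_of_notMem (Set.disjoint_left.1 (h.phase_disjoint hm.symm) hx) _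
  · simp

theorem phaseFun_eventually_eq (h : M.IsCluster Ω q Ph) (β : Fin M.numPhase → ℝ)
    {x : Pt n} (hxΩ : x ∈ Ω) (hx : x ∉ M.cluster q) :
    ∀ᶠ y in 𝓝 x, M.phaseFun β Ph y = M.phaseFun β Ph x := by
  rw [h.domain_eq] at hxΩ
  obtain ⟨ℓ, hℓ⟩ := Set.mem_iUnion.1 (hxΩ.resolve_left hx)
  filter_upwards [(h.phase_open ℓ).mem_nhds hℓ] with y hy
  rw [h.phaseFun_of_mem β hy, h.phaseFun_of_mem β hℓ]

/-- A point of an open simplex lies in no other closed simplex. -/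
theorem eq_of_mem (h : M.IsCluster Ω q Ph) {c c' : M.Cell} {y : Pt n}
    (hy : y ∈ openSimplex (M.cell q c)) (hy' : y ∈ closedSimplex (M.cell q c')) : c = c' := by
  by_contra hne
  obtain ⟨w, hw0, hw1, hw⟩ := id hy
  have hmem : y ∈ convexHull ℝ (Set.range (M.cell q c) ∩ Set.range (M.cell q c')) :=
    (h.conforming c.1 c.2 c'.1 c'.2) ▸ ⟨openSimplex_subset_closedSimplex _ hy, hy'⟩
  rw [hw] at hmem
  -- All weights of y are positive, so every vertex of c belongs to the common face. The two cells
  -- then have the same vertices up to order, hence the same open simplex, against `open_disjoint`.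
  have hall : ∀ a, ∃ b, M.cell q c' b = M.cell q c a := fun a =>
    (mem_of_mem_convexHull_of_pos (h.affineIndependent c) Set.inter_subset_left hw1 hmem
      (hw0 a).ne').2
  choose f hf using hall
  have hinj : Function.Injective f := fun a b hab =>
    (h.affineIndependent c).injective (by rw [← hf a, ← hf b, hab])
  let e := Equiv.ofBijective f (Finite.injective_iff_bijective.1 hinj)
  refine Set.disjoint_left.1 (h.open_disjoint c.1 c.2 c'.1 c'.2 hne) hy
    ⟨w ∘ e.symm, fun a => hw0 _, ?_, ?_⟩
  · rw [← hw1]; exact e.symm.sum_comp w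
  · rw [hw, ← e.sum_comp (fun a => (w ∘ e.symm) a • M.corners q c'.1 c'.2 a)]
    refine Finset.sum_congr rfl fun a _ => ?_
    rw [Function.comp_apply, Equiv.symm_apply_apply]
    exact congrArg _ (hf a).symm

/-- Near a point of an open simplex, the two sides of the simplex belong to the two adjacent
phases. -/
theorem eventually_side (h : M.IsCluster Ω q Ph) (hΩ : IsOpen Ω) {c : M.Cell} {y : Pt n}
    (hy : y ∈ openSimplex (M.cell q c)) :
    ∀ᶠ z in 𝓝 y, (0 < inner ℝ (areaNormal (M.cell q c)) (z - y) → z ∈ Ph (M.plus c.1)) ∧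
      (inner ℝ (areaNormal (M.cell q c)) (z - y) < 0 → z ∈ Ph (M.minus c.1)) := by
  set N := areaNormal (M.cell q c) with hN
  have hN0 : N ≠ 0 := areaNormal_ne_zero (h.affineIndependent c)
  have hyc := openSimplex_subset_closedSimplex _ hy
  have hnear : ∀ᶠ z in 𝓝 y, z ∈ Ω ∧ ∀ c', c' ≠ c → z ∉ closedSimplex (M.cell q c') := by
    refine (hΩ.eventually_mem
      (h.subset_domain (closedSimplex_subset_cluster q c hyc))).and ?_
    refine Filter.eventually_all.2 fun c' => ?_
    by_cases hc : c' = c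
    · simp [hc]
    · have : y ∉ closedSimplex (M.cell q c') := fun h' => hc (h.eq_of_mem hy h').symm
      filter_upwards [(isClosed_closedSimplex _).isOpen_compl.mem_nhds this] with z hz _ using hz
  obtain ⟨ε, hε, hball⟩ := Metric.eventually_nhds_iff_ball.1 hnear
  have hcover : ∀ z ∈ Metric.ball y ε, inner ℝ N (z - y) ≠ 0 → z ∈ ⋃ ℓ, Ph ℓ := by
    intro z hz hne
    have h1 := hball z hz
    have h2 : z ∉ M.cluster q := by
      intro hzc
      obtain ⟨c', hc'⟩ := exists_of_mem_cluster hzc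
      by_cases hcc : c' = c
      · subst hcc
        exact hne (inner_areaNormal_sub_of_mem hc' hyc)
      · exact h1.2 c' hcc hc'
    have h3 := h1.1
    rw [h.domain_eq] at h3
    exact h3.resolve_left h2
  -- Half of a small ball is convex and misses the cluster, so it lies in a single one of the
  -- disjoint open phases; the points next to y on the normal line tell in which. The sign of s
  -- selects the half.
  have hside : ∀ (s : ℝ) (ℓ : Fin M.numPhase), s ≠ 0 →
      (∀ᶠ e : ℝ in 𝓝[>] 0, y + e • (s • N) ∈ Ph ℓ) →
      ∀ z ∈ Metric.ball y ε, 0 < s * inner ℝ N (z - y) → z ∈ Ph ℓ := by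
    intro s ℓ hs hev
    have hlin : IsLinearMap ℝ fun z : Pt n => s * inner ℝ N z :=
      ⟨fun a b => by rw [inner_add_right, mul_add],
        fun a b => by rw [inner_smul_right, smul_eq_mul]; ring⟩
    set H := Metric.ball y ε ∩ {z | s * inner ℝ N y < s * inner ℝ N z} with hH
    have hconv : IsPreconnected H :=
      ((convex_ball y ε).inter (convex_halfSpace_gt hlin _)).isPreconnected
    have hHsub : H ⊆ Ph ℓ ∪ ⋃ m ∈ {m | m ≠ ℓ}, Ph m := by
      rintro z ⟨hz, hz'⟩
      have hne : inner ℝ N (z - y) ≠ 0 := by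
        intro h0
        rw [inner_sub_right, sub_eq_zero] at h0
        simp [h0] at hz'
      obtain ⟨m, hm⟩ := Set.mem_iUnion.1 (hcover z hz hne)
      by_cases hml : m = ℓ
      · exact Or.inl (hml ▸ hm)
      · exact Or.inr (Set.mem_biUnion hml hm)
    have hne : (H ∩ Ph ℓ).Nonempty := by
      have hb : ∀ᶠ e : ℝ in 𝓝[>] 0, y + e • (s • N) ∈ Metric.ball y ε := by
        have hc : Tendsto (fun e : ℝ => y + e • (s • N)) (𝓝 0) (𝓝 (y + (0 : ℝ) • (s • N))) :=
          Continuous.tendsto (by fun_prop) 0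
        rw [zero_smul, add_zero] at hc
        exact (hc.eventually (Metric.ball_mem_nhds y hε)).filter_mono nhdsWithin_le_nhds
      obtain ⟨e, ⟨he1, he2⟩, he⟩ := ((hev.and hb).and self_mem_nhdsWithin).exists
      refine ⟨_, ⟨he2, ?_⟩, he1⟩
      rw [Set.mem_ofPred_eq, inner_add_right, inner_smul_right, inner_smul_right,
        real_inner_self_eq_norm_sq, mul_add]
      have : 0 < e * (s * s) * ‖N‖ ^ 2 :=
        mul_pos (mul_pos he (mul_self_pos.2 hs)) (by positivity)
      nlinarith
    have hsub := hconv.subset_left_of_subset_union (h.phase_open ℓ)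
      (isOpen_biUnion fun m _ => h.phase_open m)
      (Set.disjoint_iUnion₂_right.2 fun m hm => h.phase_disjoint (Ne.symm hm)) hHsub hne
    intro z hz hpos
    refine hsub ⟨hz, ?_⟩
    rw [inner_sub_right, mul_sub] at hpos
    exact sub_pos.1 hpos
  have hns : ∀ᶠ e : ℝ in 𝓝[>] 0, y + e • N ∈ Ph (M.plus c.1) ∧ y - e • N ∈ Ph (M.minus c.1) :=
    h.normal_side c.1 c.2 y hy
  filter_upwards [Metric.ball_mem_nhds y hε] with z hz
  constructor
  · intro hp
    refine hside 1 _ one_ne_zero ?_ z hz (by simpa using hp)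
    filter_upwards [hns] with e he
    simpa using he.1
  · intro hp
    refine hside (-1) _ (by norm_num) ?_ z hz (by simpa using hp)
    filter_upwards [hns] with e he
    simpa [← sub_eq_add_neg] using he.2

open Classical in
/-- The jumps of the phase function along a curve that crosses the cluster transversally. -/
theorem eventually_phaseFun_eq (h : M.IsCluster Ω q Ph) (hΩ : IsOpen Ω)
    (β : Fin M.numPhase → ℝ) {γ : ℝ → Pt n} {t : ℝ} {v : Pt n} (hγ : HasDerivAt γ v t)
    (ht : γ t ∈ Ω)
    (htr : ∀ c, γ t ∈ closedSimplex (M.cell q c) → γ t ∈ openSimplex (M.cell q c) ∧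
      inner ℝ (areaNormal (M.cell q c)) v ≠ 0) :
    ∃ k, ∀ᶠ s in 𝓝[≠] t, M.phaseFun β Ph (γ s) = k +
      ∑ c, if γ t ∈ closedSimplex (M.cell q c) then
        M.jump β c.1 * (SignType.sign (inner ℝ (areaNormal (M.cell q c)) v) : ℝ) *
          (if t < s then 1 else 0) else 0 := by
  by_cases hcl : γ t ∈ M.cluster q
  · obtain ⟨c, hc⟩ := exists_of_mem_cluster hcl
    obtain ⟨hco, hcv⟩ := htr c hc
    have hsum : ∀ s, (∑ c, if γ t ∈ closedSimplex (M.cell q c) then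
        M.jump β c.1 * (SignType.sign (inner ℝ (areaNormal (M.cell q c)) v) : ℝ) *
          (if t < s then 1 else 0) else 0) =
        M.jump β c.1 * (SignType.sign (inner ℝ (areaNormal (M.cell q c)) v) : ℝ) *
          (if t < s then 1 else 0) := by
      intro s
      rw [Finset.sum_eq_single c, if_pos hc]
      · intro c' _ hne
        exact if_neg fun hc' => hne (h.eq_of_mem hco hc').symm
      · simp
    simp only [hsum]
    set N := areaNormal (M.cell q c)
    have hder : HasDerivAt (fun s => inner ℝ N (γ s)) (inner ℝ N v) t := by
      simpa using (hasDerivAt_const t N).inner ℝ hγ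
    have hslope := hasDerivAt_iff_tendsto_slope.1 hder
    have hev : ∀ᶠ s in 𝓝[≠] t,
        (0 < inner ℝ N (γ s - γ t) → γ s ∈ Ph (M.plus c.1)) ∧
        (inner ℝ N (γ s - γ t) < 0 → γ s ∈ Ph (M.minus c.1)) :=
      (hγ.continuousAt.eventually (h.eventually_side hΩ hco)).filter_mono nhdsWithin_le_nhds
    -- The slope tends to N · v ≠ 0, so the side on which γ s lies is decided by the sign of s - t.
    have hsl : ∀ s, s ≠ t → inner ℝ N (γ s - γ t) =
        (s - t) * slope (fun s => inner ℝ N (γ s)) t s := by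
      intro s hs
      have : s - t ≠ 0 := sub_ne_zero.2 hs
      rw [slope_def_field, inner_sub_right]
      field_simp
    -- A curve that crosses against the normal comes from the plus phase, one that follows it from
    -- the minus phase; k is the value before the crossing.
    rcases lt_or_gt_of_ne hcv with hneg | hpos
    · refine ⟨β (M.plus c.1), ?_⟩
      filter_upwards [hev, self_mem_nhdsWithin, hslope.eventually (gt_mem_nhds hneg)]
        with s hs hst hsn
      rw [hsl s hst] at hs
      rw [sign_neg hneg]
      rcases lt_or_gt_of_ne hst with hlt | hgt
      · rw [h.phaseFun_of_mem β (hs.1 (mul_pos_of_neg_of_neg (by linarith) hsn)),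
          if_neg hlt.not_gt]
        simp
      · rw [h.phaseFun_of_mem β (hs.2 (mul_neg_of_pos_of_neg (by linarith) hsn)), if_pos hgt]
        simp [jump]
    · refine ⟨β (M.minus c.1), ?_⟩
      filter_upwards [hev, self_mem_nhdsWithin, hslope.eventually (lt_mem_nhds hpos)]
        with s hs hst hsn
      rw [hsl s hst] at hs
      rw [sign_pos hpos]
      rcases lt_or_gt_of_ne hst with hlt | hgt
      · rw [h.phaseFun_of_mem β (hs.2 (mul_neg_of_neg_of_pos (by linarith) hsn)),
          if_neg hlt.not_gt]
        simp
      · rw [h.phaseFun_of_mem β (hs.1 (mul_pos (by linarith) hsn)), if_pos hgt]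
        simp [jump]
  · refine ⟨M.phaseFun β Ph (γ t), ?_⟩
    have hz : ∀ c, γ t ∉ closedSimplex (M.cell q c) := fun c hc =>
      hcl (closedSimplex_subset_cluster q c hc)
    simp only [hz, if_false, Finset.sum_const_zero, add_zero]
    exact (hγ.continuousAt.eventually (h.phaseFun_eventually_eq β ht hcl)).filter_mono
      nhdsWithin_le_nhds

end IsCluster

end ClusterMesh

end Stefan

end

noncomputable section

namespace Stefan

open Filter Topology MeasureTheory

/-! ### The cone with apex `0` over a simplex -/

/-- The unit corner simplex. -/
def cornerSimplex (n : ℕ) : Set (Pt n) := {c | (∀ a, 0 ≤ c a) ∧ ∑ a, c a ≤ 1}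

/-- The linear map that sends the standard basis to the vertices of a simplex. -/
def vertexMap {n : ℕ} (p : Fin (n + 1) → Pt n) : Pt n →ₗ[ℝ] Pt n :=
  Matrix.toLin (EuclideanSpace.basisFun (Fin (n + 1)) ℝ).toBasis
    (EuclideanSpace.basisFun (Fin (n + 1)) ℝ).toBasis (Matrix.of fun k a => p a k)

/-- The convex hull of the origin and of a simplex. -/
def cone {n : ℕ} (p : Fin (n + 1) → Pt n) : Set (Pt n) := vertexMap p '' cornerSimplex n

theorem vertexMap_apply {n : ℕ} (p : Fin (n + 1) → Pt n) (c : Pt n) :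
    vertexMap p c = ∑ a, c a • p a := by
  ext k
  simp [vertexMap, Matrix.toLin_apply, Matrix.mulVec, dotProduct, mul_comm, Pi.single_apply]

theorem det_vertexMap {n : ℕ} (p : Fin (n + 1) → Pt n) :
    LinearMap.det (vertexMap p) = vecDet n p := by
  rw [vertexMap, LinearMap.det_toLin, vecDet_apply, ← Matrix.det_transpose]
  rfl

theorem isCompact_cornerSimplex (n : ℕ) : IsCompact (cornerSimplex n) := by
  refine Metric.isCompact_of_isClosed_isBounded ?_ ?_
  · refine IsClosed.inter (s₁ := {c : Pt n | ∀ a, 0 ≤ c a}) (s₂ := {c : Pt n | ∑ a, c a ≤ 1}) ?_ ?_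
    · simp only [Set.ofPred_forall]
      exact isClosed_iInter fun a => isClosed_le continuous_const (by fun_prop)
    · exact isClosed_le (by fun_prop) continuous_const
  · refine isBounded_iff_forall_norm_le.2 ⟨Real.sqrt (n + 1), fun c hc => ?_⟩
    rw [EuclideanSpace.norm_eq]
    refine Real.sqrt_le_sqrt ?_
    have hle : ∀ a, c a ≤ 1 := fun a =>
      (Finset.single_le_sum (fun b _ => hc.1 b) (Finset.mem_univ a)).trans hc.2
    calc ∑ a, ‖c a‖ ^ 2 ≤ ∑ _a : Fin (n + 1), (1 : ℝ) := by
          refine Finset.sum_le_sum fun a _ => ?_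
          rw [Real.norm_eq_abs, sq_abs]
          exact pow_le_one₀ (hc.1 a) (hle a)
      _ = n + 1 := by simp

theorem isCompact_cone {n : ℕ} (p : Fin (n + 1) → Pt n) : IsCompact (cone p) :=
  (isCompact_cornerSimplex n).image (vertexMap p).continuous_of_finiteDimensional

theorem volume_cone {n : ℕ} (p : Fin (n + 1) → Pt n) :
    volume (cone p) = ENNReal.ofReal |vecDet n p| * volume (cornerSimplex n) := by
  rw [cone, Measure.addHaar_image_linearMap, det_vertexMap]

/-- A cone point with coefficients c is moved onto the simplex by the factor 1 / ∑ c ≥ 1, so r =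
-log (∑ c). The exponential parametrisation of the ray puts x at time 0 and makes the velocity equal
to the position. -/
theorem mem_cone_iff {n : ℕ} {p : Fin (n + 1) → Pt n} {x : Pt n} (hx : x ≠ 0) :
    x ∈ cone p ↔ ∃ r : ℝ, 0 ≤ r ∧ Real.exp r • x ∈ closedSimplex p := by
  constructor
  · rintro ⟨c, ⟨hc0, hc1⟩, rfl⟩
    rw [vertexMap_apply] at hx ⊢
    have hpos : 0 < ∑ a, c a := by
      refine lt_of_le_of_ne (Finset.sum_nonneg fun a _ => hc0 a) fun h0 => hx ?_
      have := (Finset.sum_eq_zero_iff_of_nonneg fun a _ => hc0 a).1 h0.symm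
      exact Finset.sum_eq_zero fun a ha => by rw [this a ha, zero_smul]
    refine ⟨-Real.log (∑ a, c a), ?_, ?_⟩
    · have := Real.log_nonpos hpos.le hc1
      linarith
    · rw [Real.exp_neg, Real.exp_log hpos]
      refine mem_closedSimplex_iff.2 ⟨fun a => (∑ a, c a)⁻¹ * c a, fun a => ?_, ?_, ?_⟩
      · have := hc0 a; positivity
      · rw [← Finset.mul_sum, inv_mul_cancel₀ hpos.ne']
      · simp [Finset.smul_sum, smul_smul]
  · rintro ⟨r, hr, hx'⟩
    obtain ⟨w, hw0, hw1, hw⟩ := mem_closedSimplex_iff.1 hx'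
    refine ⟨WithLp.toLp 2 fun a => Real.exp (-r) * w a, ⟨fun a => ?_, ?_⟩, ?_⟩
    · have := hw0 a
      simp only
      positivity
    · simp only [← Finset.mul_sum, hw1, mul_one]
      exact Real.exp_le_one_iff.2 (by linarith)
    · rw [vertexMap_apply]
      simp only [mul_smul, ← Finset.smul_sum, ← hw]
      rw [smul_smul, ← Real.exp_add]
      simp

/-! ### Rays through a simplex -/

/-- The ray through `x` meets the simplex before time `s`. -/
def Crossed {n : ℕ} (p : Fin (n + 1) → Pt n) (x : Pt n) (s : ℝ) : Prop :=
  ∃ r < s, Real.exp r • x ∈ closedSimplex p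

/-- N · y is constant on the simplex but strictly monotone along the ray. -/
theorem crossing_unique {n : ℕ} {p : Fin (n + 1) → Pt n} {x : Pt n}
    (hx : inner ℝ (areaNormal p) x ≠ 0) {r s : ℝ} (hr : Real.exp r • x ∈ closedSimplex p)
    (hs : Real.exp s • x ∈ closedSimplex p) : r = s := by
  have h := inner_areaNormal_sub_of_mem hr hs
  rw [← sub_smul, inner_smul_right] at h
  exact Real.exp_injective (sub_eq_zero.1 ((mul_eq_zero.1 h).resolve_right hx))

theorem crossed_iff_of_mem {n : ℕ} {p : Fin (n + 1) → Pt n} {x : Pt n}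
    (hx : inner ℝ (areaNormal p) x ≠ 0) {t : ℝ} (ht : Real.exp t • x ∈ closedSimplex p) (s : ℝ) :
    Crossed p x s ↔ t < s :=
  ⟨fun ⟨_, hr, h⟩ => crossing_unique hx h ht ▸ hr, fun h => ⟨t, h, ht⟩⟩

theorem crossed_eventually_of_notMem {n : ℕ} {p : Fin (n + 1) → Pt n} {x : Pt n}
    (hx : inner ℝ (areaNormal p) x ≠ 0) {t : ℝ} (ht : Real.exp t • x ∉ closedSimplex p) :
    ∀ᶠ s in 𝓝 t, (Crossed p x s ↔ Crossed p x t) := by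
  by_cases h : ∃ r, Real.exp r • x ∈ closedSimplex p
  · obtain ⟨r, hr⟩ := h
    have hne : r ≠ t := by rintro rfl; exact ht hr
    simp only [crossed_iff_of_mem hx hr]
    rcases lt_or_gt_of_ne hne with h | h
    · filter_upwards [lt_mem_nhds h] with s hs using iff_of_true hs h
    · filter_upwards [gt_mem_nhds h] with s hs using iff_of_false hs.not_gt h.not_gt
  · push Not at h
    exact Eventually.of_forall fun s =>
      iff_of_false (fun ⟨r, _, hr⟩ => h r hr) (fun ⟨r, _, hr⟩ => h r hr)

open Classical in
theorem exists_crossed_eventually {n : ℕ} {p : Fin (n + 1) → Pt n} {x : Pt n}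
    (hx : inner ℝ (areaNormal p) x ≠ 0) (t : ℝ) :
    ∃ k : ℝ, ∀ᶠ s in 𝓝 t, (if Crossed p x s then (1 : ℝ) else 0) =
      k + if Real.exp t • x ∈ closedSimplex p then (if t < s then 1 else 0) else 0 := by
  by_cases ht : Real.exp t • x ∈ closedSimplex p
  · refine ⟨0, Eventually.of_forall fun s => ?_⟩
    simp only [crossed_iff_of_mem hx ht, ht, if_true, zero_add]
  · refine ⟨if Crossed p x t then 1 else 0, ?_⟩
    filter_upwards [crossed_eventually_of_notMem hx ht] with s hs
    simp [hs, ht]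

/-! ### Crossing counts along rays and the energy content. -/

namespace ClusterMesh

variable {n : ℕ} {M : ClusterMesh n} {Ω : Set (Pt n)} {q q' : M.Config}
  {Ph Ph' : Fin M.numPhase → Set (Pt n)}

/-- Points that are in general position with respect to the rays through the cluster. -/
structure Generic (q : M.Config) (x : Pt n) : Prop where
  ne_zero : x ≠ 0
  notMem : x ∉ M.cluster q
  inner_ne_zero : ∀ c, inner ℝ (areaNormal (M.cell q c)) x ≠ 0
  notMem_span : ∀ c (b : Fin (n + 1)),
    x ∉ Submodule.span ℝ (Set.range (M.cell q c ∘ b.succAbove))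

/-- A vanishing barycentric coordinate would put x into the span of n vertices. -/
theorem Generic.mem_openSimplex {x : Pt n} (hx : Generic q x) {c : M.Cell} {t : ℝ}
    (h : Real.exp t • x ∈ closedSimplex (M.cell q c)) :
    Real.exp t • x ∈ openSimplex (M.cell q c) := by
  obtain ⟨w, hw0, hw1, hw⟩ := mem_closedSimplex_iff.1 h
  refine ⟨w, fun b => lt_of_le_of_ne (hw0 b) fun hb => hx.notMem_span c b ?_, hw1, hw⟩
  have h1 : Real.exp t • x ∈ Submodule.span ℝ (Set.range (M.cell q c ∘ b.succAbove)) := by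
    rw [hw, Fin.sum_univ_succAbove _ b, ← hb, zero_smul, zero_add]
    exact Submodule.sum_mem _ fun a _ =>
      Submodule.smul_mem _ _ (Submodule.subset_span ⟨a, rfl⟩)
  exact (Submodule.smul_mem_iff _ (Real.exp_pos t).ne').1 h1

open Classical in
/-- The sum of the jumps that the ray through `x` has met before time `s`. -/
def rayJumps (β : Fin M.numPhase → ℝ) (q : M.Config) (x : Pt n) (s : ℝ) : ℝ :=
  ∑ c : M.Cell, M.jump β c.1 * (SignType.sign (inner ℝ (areaNormal (M.cell q c)) x) : ℝ) *
    (if Crossed (M.cell q c) x s then 1 else 0)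

-- The sum on the right is the one in `IsCluster.eventually_phaseFun_eq`, so that the jumps of the
-- phase function and of the count cancel on subtraction.
open Classical in
theorem Generic.exists_rayJumps_eventually {x : Pt n} (hx : Generic q x)
    (β : Fin M.numPhase → ℝ) (t : ℝ) :
    ∃ k : ℝ, ∀ᶠ s in 𝓝 t, rayJumps β q x s = k +
      ∑ c, if Real.exp t • x ∈ closedSimplex (M.cell q c) then
        M.jump β c.1 * (SignType.sign (inner ℝ (areaNormal (M.cell q c)) x) : ℝ) *
          (if t < s then 1 else 0) else 0 := by
  choose k hk using fun c => exists_crossed_eventually (hx.inner_ne_zero c) t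
  refine ⟨∑ c : M.Cell, M.jump β c.1 *
    (SignType.sign (inner ℝ (areaNormal (M.cell q c)) x) : ℝ) * k c, ?_⟩
  filter_upwards [Filter.eventually_all.2 hk] with s hs
  rw [rayJumps, ← Finset.sum_add_distrib]
  refine Finset.sum_congr rfl fun c _ => ?_
  rw [hs c, mul_add, mul_ite, mul_zero]

theorem Generic.exists_rayJumps_eventually_eq {x : Pt n} (hx : Generic q x)
    (β : Fin M.numPhase → ℝ) {t : ℝ} (ht : Real.exp t • x ∉ M.cluster q) :
    ∀ᶠ s in 𝓝 t, rayJumps β q x s = rayJumps β q x t := by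
  classical
  obtain ⟨k, hk⟩ := hx.exists_rayJumps_eventually β t
  have hz : ∀ c, Real.exp t • x ∉ closedSimplex (M.cell q c) := fun c hc =>
    ht (closedSimplex_subset_cluster q c hc)
  simp only [hz, if_false, Finset.sum_const_zero, add_zero] at hk
  filter_upwards [hk] with s hs
  rw [hs, hk.self_of_nhds]

theorem hasDerivAt_ray (x : Pt n) (t : ℝ) :
    HasDerivAt (fun s => Real.exp s • x) (Real.exp t • x) t :=
  (Real.hasDerivAt_exp t).smul_const x

/-- The velocity of the ray is a positive multiple of x, so the crossing signs in the phase function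
are those used by `rayJumps`. -/
theorem IsCluster.exists_ray_eventually_eq (h : M.IsCluster Ω q Ph) (hΩ : IsOpen Ω)
    (β : Fin M.numPhase → ℝ) {x : Pt n} (hx : Generic q x) {t : ℝ}
    (ht : Real.exp t • x ∈ Ω) :
    ∃ k, ∀ᶠ s in 𝓝[≠] t, M.phaseFun β Ph (Real.exp s • x) - rayJumps β q x s = k := by
  classical
  have hsgn : ∀ c : M.Cell, SignType.sign (inner ℝ (areaNormal (M.cell q c)) (Real.exp t • x)) =
      SignType.sign (inner ℝ (areaNormal (M.cell q c)) x) := fun c => by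
    rw [inner_smul_right, sign_mul, sign_pos (Real.exp_pos t), one_mul]
  obtain ⟨k, hk⟩ := h.eventually_phaseFun_eq hΩ β (hasDerivAt_ray x t) ht fun c hc =>
    ⟨hx.mem_openSimplex hc, by
      rw [inner_smul_right]
      exact mul_ne_zero (Real.exp_pos t).ne' (hx.inner_ne_zero c)⟩
  obtain ⟨k', hk'⟩ := hx.exists_rayJumps_eventually β t
  refine ⟨k - k', ?_⟩
  filter_upwards [hk, hk'.filter_mono nhdsWithin_le_nhds] with s hs hs'
  rw [hs, hs']
  simp only [hsgn]
  ring

/-- The signed multiplicity with which the cones over the cluster cover a point, weighted by the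
jumps. -/
def coneSum (β : Fin M.numPhase → ℝ) (q : M.Config) (x : Pt n) : ℝ :=
  ∑ c : M.Cell, (cone (M.cell q c)).indicator (fun _ => M.jump β c.1 *
    ((-1) ^ n * (SignType.sign (vecDet n (M.cell q c)) : ℝ))) x

/-- The cells met in the time interval [0, s) are those whose cone contains x. On the cell, N · y =
(-1)^n `vecDet`, which relates the crossing sign to the orientation of the cone. -/
theorem Generic.rayJumps_sub {x : Pt n} (hx : Generic q x) (β : Fin M.numPhase → ℝ) {s : ℝ}
    (hs : ∀ r, Real.exp r • x ∈ M.cluster q → r < s) :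
    rayJumps β q x s - rayJumps β q x 0 = coneSum β q x := by
  classical
  rw [rayJumps, rayJumps, coneSum, ← Finset.sum_sub_distrib]
  refine Finset.sum_congr rfl fun c _ => ?_
  rw [Set.indicator_apply, mem_cone_iff hx.ne_zero]
  by_cases h : ∃ r, Real.exp r • x ∈ closedSimplex (M.cell q c)
  · obtain ⟨r, hr⟩ := h
    have hxc := hx.inner_ne_zero c
    have hiff : (∃ r', 0 ≤ r' ∧ Real.exp r' • x ∈ closedSimplex (M.cell q c)) ↔ 0 ≤ r :=
      ⟨fun ⟨r', h0, h'⟩ => crossing_unique hxc h' hr ▸ h0, fun h0 => ⟨r, h0, hr⟩⟩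
    have hsgn : (SignType.sign (inner ℝ (areaNormal (M.cell q c)) x) : ℝ) =
        (-1) ^ n * (SignType.sign (vecDet n (M.cell q c)) : ℝ) := by
      have h1 := inner_areaNormal_of_mem hr
      rw [inner_smul_right] at h1
      have h2 := congrArg SignType.sign h1
      rw [sign_mul, sign_pos (Real.exp_pos r), one_mul, sign_mul, sign_pow] at h2
      rw [h2]
      simp
    rw [crossed_iff_of_mem hxc hr, crossed_iff_of_mem hxc hr, hiff, hsgn,
      if_pos (hs r (closedSimplex_subset_cluster q c hr))]
    by_cases h0 : 0 ≤ r
    · rw [if_neg h0.not_gt, if_pos h0]; ring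
    · rw [if_pos (not_le.1 h0), if_neg h0]; ring
  · push Not at h
    have h1 : ∀ t, ¬ Crossed (M.cell q c) x t := fun t ⟨r, _, hr⟩ => h r hr
    rw [if_neg (h1 s), if_neg (h1 0), if_neg fun ⟨r, _, hr⟩ => h r hr]
    ring

theorem IsCluster.phaseFun_of_notMem (h : M.IsCluster Ω q Ph) (β : Fin M.numPhase → ℝ) {x : Pt n}
    (hx : x ∉ Ω) : M.phaseFun β Ph x = 0 :=
  Finset.sum_eq_zero fun ℓ _ => Set.indicator_of_notMem (fun hℓ => hx (h.phase_subset ℓ hℓ)) _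

/-- Outside of the domain, the phase functions of two clusters with the same phases near the
boundary locally coincide. -/
theorem phaseFun_sub_eventually (h : M.IsCluster Ω q Ph) (h' : M.IsCluster Ω q' Ph')
    (hbdry : ∀ x ∈ frontier Ω, ∀ ℓ, ∀ᶠ y in 𝓝 x, y ∈ Ph ℓ ↔ y ∈ Ph' ℓ)
    (hΩ : IsOpen Ω) (β : Fin M.numPhase → ℝ) {x : Pt n} (hx : x ∉ Ω) :
    ∀ᶠ y in 𝓝 x, M.phaseFun β Ph' y - M.phaseFun β Ph y = 0 := by
  by_cases hcl : x ∈ closure Ω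
  · have hfr : x ∈ frontier Ω := ⟨hcl, by rwa [hΩ.interior_eq]⟩
    filter_upwards [Filter.eventually_all.2 (hbdry x hfr)] with y hy
    rw [sub_eq_zero, phaseFun, phaseFun]
    refine Finset.sum_congr rfl fun ℓ _ => ?_
    classical
    rw [Set.indicator_apply, Set.indicator_apply, hy ℓ]
  · filter_upwards [isClosed_closure.isOpen_compl.mem_nhds hcl] with y hy
    have hyΩ : y ∉ Ω := fun h => hy (subset_closure h)
    rw [h.phaseFun_of_notMem β hyΩ, h'.phaseFun_of_notMem β hyΩ, sub_zero]

theorem phaseFun_sub_eq_coneSum_sub (h : M.IsCluster Ω q Ph) (h' : M.IsCluster Ω q' Ph')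
    (hbdry : ∀ x ∈ frontier Ω, ∀ ℓ, ∀ᶠ y in 𝓝 x, y ∈ Ph ℓ ↔ y ∈ Ph' ℓ)
    (hΩ : IsOpen Ω) (hΩb : Bornology.IsBounded Ω) (β : Fin M.numPhase → ℝ) {x : Pt n}
    (hx : Generic q x) (hx' : Generic q' x) :
    M.phaseFun β Ph' x - M.phaseFun β Ph x = coneSum β q x - coneSum β q' x := by
  -- While the ray is in Ω, `rayJumps` follows each phase function. While it is outside, the
  -- difference of the phase functions vanishes locally and the counts are locally constant, since
  -- both clusters lie in Ω. The ray may thus leave and re-enter Ω.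
  obtain ⟨K, hK⟩ := exists_eventually_eq_of_punctured (h := fun s =>
      (M.phaseFun β Ph' (Real.exp s • x) - M.phaseFun β Ph (Real.exp s • x)) -
        (rayJumps β q' x s - rayJumps β q x s)) fun t => by
    by_cases ht : Real.exp t • x ∈ Ω
    · obtain ⟨k, hk⟩ := h.exists_ray_eventually_eq hΩ β hx ht
      obtain ⟨k', hk'⟩ := h'.exists_ray_eventually_eq hΩ β hx' ht
      refine ⟨k' - k, ?_⟩
      filter_upwards [hk, hk'] with s hs hs'
      rw [← hs, ← hs']
      ring
    · refine ⟨-(rayJumps β q' x t - rayJumps β q x t), Eventually.filter_mono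
        nhdsWithin_le_nhds ?_⟩
      filter_upwards [(hasDerivAt_ray x t).continuousAt.eventually
          (phaseFun_sub_eventually h h' hbdry hΩ β ht),
        hx.exists_rayJumps_eventually_eq β (fun hc => ht (h.subset_domain hc)),
        hx'.exists_rayJumps_eventually_eq β (fun hc => ht (h'.subset_domain hc))] with s h1 h2 h3
      rw [h1, h2, h3, zero_sub]
  obtain ⟨R, hR⟩ := isBounded_iff_forall_norm_le.1 hΩb
  have hfar : ∀ᶠ s in atTop, ∀ r, s ≤ r → Real.exp r • x ∉ Ω := by
    have hx0 : 0 < ‖x‖ := norm_pos_iff.2 hx.ne_zero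
    have := (Real.tendsto_exp_atTop.atTop_mul_const hx0).eventually_gt_atTop R
    filter_upwards [this] with s hs r hr hmem
    have h1 := hR _ hmem
    rw [norm_smul, Real.norm_eq_abs, abs_of_pos (Real.exp_pos r)] at h1
    have := mul_le_mul_of_nonneg_right (Real.exp_le_exp.2 hr) hx0.le
    linarith
  obtain ⟨T, hT⟩ := hfar.exists
  -- Far out both phase functions vanish, so K is determined by the counts alone.
  have hend : coneSum β q x - coneSum β q' x =
      K + (rayJumps β q' x 0 - rayJumps β q x 0) := by
    obtain ⟨s, hs, hTs⟩ := ((hK (T + 1)).and (nhdsWithin_le_nhds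
      (lt_mem_nhds (lt_add_one T)))).exists
    have hnot := hT s hTs.le
    rw [h.phaseFun_of_notMem β hnot, h'.phaseFun_of_notMem β hnot] at hs
    have hlt : ∀ r, Real.exp r • x ∈ Ω → r < s := fun r hr => by
      by_contra hle
      exact hT r (hTs.le.trans (not_lt.1 hle)) hr
    rw [← hx.rayJumps_sub β (fun r hr => hlt r (h.subset_domain hr)),
      ← hx'.rayJumps_sub β (fun r hr => hlt r (h'.subset_domain hr)), ← hs]
    ring
  have hx0 : Real.exp 0 • x = x := by simp
  -- x lies on neither cluster, so the statement on a punctured neighbourhood of time 0 extends to x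
  -- itself.
  have hw : ∀ᶠ y in 𝓝 x, M.phaseFun β Ph' y - M.phaseFun β Ph y =
      M.phaseFun β Ph' x - M.phaseFun β Ph x := by
    by_cases hxΩ : x ∈ Ω
    · filter_upwards [h.phaseFun_eventually_eq β hxΩ hx.notMem,
        h'.phaseFun_eventually_eq β hxΩ hx'.notMem] with y h1 h2
      rw [h1, h2]
    · have := phaseFun_sub_eventually h h' hbdry hΩ β hxΩ
      filter_upwards [this] with y hy
      rw [hy, this.self_of_nhds]
  have hc := (hasDerivAt_ray x 0).continuousAt
  rw [ContinuousAt, hx0] at hc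
  obtain ⟨s, hs, h1, h2, h3⟩ := ((hK 0).and (nhdsWithin_le_nhds ((hc.eventually hw).and
    ((hx.exists_rayJumps_eventually_eq β (by rw [hx0]; exact hx.notMem)).and
      (hx'.exists_rayJumps_eventually_eq β (by rw [hx0]; exact hx'.notMem)))))).exists
  rw [h1, h2, h3] at hs
  rw [hend, ← hs]
  ring

/-- The exceptional points lie in finitely many proper linear or affine subspaces. -/
theorem IsCluster.ae_generic (h : M.IsCluster Ω q Ph) : ∀ᵐ x : Pt n, Generic q x := by
  have hspan : ∀ c (b : Fin (n + 1)), ∀ᵐ x : Pt n,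
      x ∉ Submodule.span ℝ (Set.range (M.cell q c ∘ b.succAbove)) := fun c b => by
    refine measure_eq_zero_iff_ae_notMem.1 (Measure.addHaar_submodule _ _ fun htop => ?_)
    have h1 := finrank_range_le_card (R := ℝ) (M.cell q c ∘ b.succAbove)
    rw [Set.finrank, htop, finrank_top] at h1
    simp at h1
  have hinner : ∀ c, ∀ᵐ x : Pt n, inner ℝ (areaNormal (M.cell q c)) x ≠ 0 := fun c => by
    refine measure_eq_zero_iff_ae_notMem.1 (Measure.addHaar_submodule volume
      (LinearMap.ker (innerₛₗ ℝ (areaNormal (M.cell q c)))) fun htop => ?_)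
    refine areaNormal_ne_zero (h.affineIndependent c) ?_
    have : areaNormal (M.cell q c) ∈ LinearMap.ker (innerₛₗ ℝ (areaNormal (M.cell q c))) :=
      htop ▸ Submodule.mem_top
    exact inner_self_eq_zero.1 (LinearMap.mem_ker.1 this)
  have hcell : ∀ c, ∀ᵐ x : Pt n, x ∉ closedSimplex (M.cell q c) := fun c => by
    refine measure_eq_zero_iff_ae_notMem.1 (measure_mono_null (convexHull_subset_affineSpan _)
      (Measure.addHaar_affineSubspace _ _ fun htop => ?_))
    have h1 := (h.affineIndependent c).finrank_vectorSpan (n := n) (by simp)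
    rw [← direction_affineSpan, htop, AffineSubspace.direction_top, finrank_top] at h1
    simp at h1
  have hzero : ∀ᵐ x : Pt n, x ≠ 0 :=
    measure_eq_zero_iff_ae_notMem.1 (measure_singleton (0 : Pt n))
  filter_upwards [hzero, ae_all_iff.2 hcell, ae_all_iff.2 hinner,
    ae_all_iff.2 fun c => ae_all_iff.2 (hspan c)] with x h0 h1 h2 h3
  exact ⟨h0, fun hx => by obtain ⟨c, hc⟩ := exists_of_mem_cluster hx; exact h1 c hc, h2, h3⟩

theorem integrable_coneSum (β : Fin M.numPhase → ℝ) (q : M.Config) :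
    Integrable (coneSum β q) :=
  integrable_finsetSum _ fun c _ => (integrable_indicator_iff
    (isCompact_cone _).isClosed.measurableSet).2
      (integrableOn_const (isCompact_cone _).measure_ne_top)

/-- Since sign · |det| = det, the absolute values disappear and a polynomial in the vertices
remains, which can be differentiated in time. -/
theorem integral_coneSum (β : Fin M.numPhase → ℝ) (q : M.Config) :
    ∫ x, coneSum β q x = (volume (cornerSimplex n)).toReal * ((-1) ^ n *
      ∑ c : M.Cell, M.jump β c.1 * vecDet n (M.cell q c)) := by
  simp only [coneSum]
  rw [integral_finsetSum]
  · simp only [Finset.mul_sum]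
    refine Finset.sum_congr rfl fun c _ => ?_
    rw [integral_indicator (isCompact_cone _).isClosed.measurableSet, setIntegral_const,
      measureReal_def, volume_cone, ENNReal.toReal_mul, ENNReal.toReal_ofReal (abs_nonneg _),
      smul_eq_mul]
    conv_rhs => rw [← sign_mul_abs (vecDet n (M.cell q c))]
    ring
  · exact fun c _ => (integrable_indicator_iff
      (isCompact_cone _).isClosed.measurableSet).2
        (integrableOn_const (isCompact_cone _).measure_ne_top)

theorem IsCluster.integrable_indicator (h : M.IsCluster Ω q Ph) (hΩb : Bornology.IsBounded Ω)
    (ℓ : Fin M.numPhase) (b : ℝ) : Integrable ((Ph ℓ).indicator fun _ => b) :=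
  (integrable_indicator_iff (h.phase_open ℓ).measurableSet).2
    (integrableOn_const (hΩb.subset (h.phase_subset ℓ)).measure_lt_top.ne)

theorem IsCluster.integrable_phaseFun (h : M.IsCluster Ω q Ph) (hΩb : Bornology.IsBounded Ω)
    (β : Fin M.numPhase → ℝ) : Integrable (M.phaseFun β Ph) :=
  integrable_finsetSum _ fun ℓ _ => h.integrable_indicator hΩb ℓ _

theorem IsCluster.integral_phaseFun (h : M.IsCluster Ω q Ph) (hΩb : Bornology.IsBounded Ω)
    (β : Fin M.numPhase → ℝ) : ∫ x, M.phaseFun β Ph x = M.energyContent β Ph := by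
  simp only [phaseFun]
  rw [integral_finsetSum _ fun ℓ _ => h.integrable_indicator hΩb ℓ _, energyContent]
  refine Finset.sum_congr rfl fun ℓ _ => ?_
  rw [integral_indicator (h.phase_open ℓ).measurableSet, setIntegral_const, measureReal_def,
    smul_eq_mul, mul_comm]

/-- The change of the energy content in terms of the signed volumes of the cones over the
simplices of the two clusters. -/
theorem energyContent_sub (h : M.IsCluster Ω q Ph) (h' : M.IsCluster Ω q' Ph')
    (hbdry : ∀ x ∈ frontier Ω, ∀ ℓ, ∀ᶠ y in 𝓝 x, y ∈ Ph ℓ ↔ y ∈ Ph' ℓ)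
    (hΩ : IsOpen Ω) (hΩb : Bornology.IsBounded Ω) (β : Fin M.numPhase → ℝ) :
    M.energyContent β Ph' - M.energyContent β Ph =
      (volume (cornerSimplex n)).toReal * ((-1) ^ n *
        (∑ c : M.Cell, M.jump β c.1 * vecDet n (M.cell q c) -
          ∑ c : M.Cell, M.jump β c.1 * vecDet n (M.cell q' c))) := by
  rw [← h.integral_phaseFun hΩb, ← h'.integral_phaseFun hΩb,
    ← integral_sub (h'.integrable_phaseFun hΩb β) (h.integrable_phaseFun hΩb β), mul_sub, mul_sub,
    ← integral_coneSum, ← integral_coneSum,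
    ← integral_sub (integrable_coneSum β q) (integrable_coneSum β q')]
  refine integral_congr_ae ?_
  filter_upwards [h.ae_generic, h'.ae_generic] with x hx hx'
  exact phaseFun_sub_eq_coneSum_sub h h' hbdry hΩ hΩb β hx hx'

end ClusterMesh

end Stefan

end

noncomputable section

namespace Stefan

open Filter Topology

/-! ### Circles around a facet -/

/-- The floor counts the passages through the angle θ modulo 2π: it has a step of height one there
and is locally constant elsewhere. -/
theorem exists_floor_eventually (θ t : ℝ) : ∃ k : ℝ, ∀ᶠ s in 𝓝[≠] t,
    (⌊(s - θ) / (2 * Real.pi)⌋ : ℝ) = k + (if t < s then 1 else 0) *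
      (Set.indicator {t : ℝ | ∃ m : ℤ, t = θ + m * (2 * Real.pi)} 1 t) := by
  have hπ : 0 < 2 * Real.pi := Real.two_pi_pos
  by_cases h : ∃ m : ℤ, t = θ + m * (2 * Real.pi)
  · rw [Set.indicator_of_mem (by exact h)]
    obtain ⟨m, hm⟩ := h
    refine ⟨m - 1, ?_⟩
    filter_upwards [self_mem_nhdsWithin, nhdsWithin_le_nhds (Ioo_mem_nhds
      (sub_lt_self t hπ) (lt_add_of_pos_right t hπ))] with s hs hs'
    rcases lt_or_gt_of_ne hs with hlt | hgt
    · have : ⌊(s - θ) / (2 * Real.pi)⌋ = m - 1 := by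
        rw [Int.floor_eq_iff, le_div_iff₀ hπ, div_lt_iff₀ hπ]
        push_cast
        constructor <;> nlinarith [hs'.1, hs'.2]
      rw [this, if_neg hlt.not_gt]
      simp
    · have : ⌊(s - θ) / (2 * Real.pi)⌋ = m := by
        rw [Int.floor_eq_iff, le_div_iff₀ hπ, div_lt_iff₀ hπ]
        constructor <;> nlinarith [hs'.1, hs'.2]
      rw [this, if_pos hgt]
      simp
  · rw [Set.indicator_of_notMem (by exact h)]
    refine ⟨⌊(t - θ) / (2 * Real.pi)⌋, nhdsWithin_le_nhds ?_⟩
    have hlt : (⌊(t - θ) / (2 * Real.pi)⌋ : ℝ) < (t - θ) / (2 * Real.pi) := by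
      refine lt_of_le_of_ne (Int.floor_le _) fun heq => h ⟨⌊(t - θ) / (2 * Real.pi)⌋, ?_⟩
      rw [heq]
      field_simp
      ring
    have hc : Tendsto (fun s => (s - θ) / (2 * Real.pi)) (𝓝 t) (𝓝 ((t - θ) / (2 * Real.pi))) :=
      Continuous.tendsto (by fun_prop) t
    filter_upwards [hc.eventually (lt_mem_nhds hlt),
      hc.eventually (gt_mem_nhds (Int.lt_floor_add_one _))] with s h1 h2
    have : ⌊(s - θ) / (2 * Real.pi)⌋ = ⌊(t - θ) / (2 * Real.pi)⌋ :=
      Int.floor_eq_iff.2 ⟨h1.le, h2⟩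
    simp [this]

/-- `e₁, e₂` is an orthonormal basis of the orthogonal complement of `U`. -/
structure IsFrame {n : ℕ} (U : Submodule ℝ (Pt n)) (e₁ e₂ : Pt n) : Prop where
  inner_11 : inner ℝ e₁ e₁ = 1
  inner_22 : inner ℝ e₂ e₂ = 1
  inner_12 : inner ℝ e₁ e₂ = 0
  mem_1 : e₁ ∈ Uᗮ
  mem_2 : e₂ ∈ Uᗮ
  eq_of_mem : ∀ y ∈ Uᗮ, y = (inner ℝ e₁ y : ℝ) • e₁ + (inner ℝ e₂ y : ℝ) • e₂

/-- The point with angle `t` on the unit circle in the plane of `e₁, e₂`. -/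
def circleDir {n : ℕ} (e₁ e₂ : Pt n) (t : ℝ) : Pt n := Real.cos t • e₁ + Real.sin t • e₂

/-- The tangent vector with angle `t` of the unit circle in the plane of `e₁, e₂`. -/
def circleTan {n : ℕ} (e₁ e₂ : Pt n) (t : ℝ) : Pt n := (-Real.sin t) • e₁ + Real.cos t • e₂

theorem hasDerivAt_circle {n : ℕ} (e₁ e₂ x : Pt n) (r t : ℝ) :
    HasDerivAt (fun t => x + r • circleDir e₁ e₂ t) (r • circleTan e₁ e₂ t) t :=
  ((((Real.hasDerivAt_cos t).smul_const e₁).add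
    ((Real.hasDerivAt_sin t).smul_const e₂)).const_smul r).const_add x

theorem circleDir_add {n : ℕ} (e₁ e₂ : Pt n) (θ : ℝ) (m : ℤ) :
    circleDir e₁ e₂ (θ + m * (2 * Real.pi)) = circleDir e₁ e₂ θ := by
  simp only [circleDir, Real.cos_add_int_mul_two_pi, Real.sin_add_int_mul_two_pi]

theorem circleTan_add {n : ℕ} (e₁ e₂ : Pt n) (θ : ℝ) (m : ℤ) :
    circleTan e₁ e₂ (θ + m * (2 * Real.pi)) = circleTan e₁ e₂ θ := by
  simp only [circleTan, Real.cos_add_int_mul_two_pi, Real.sin_add_int_mul_two_pi]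

theorem exists_isFrame {n : ℕ} (U : Submodule ℝ (Pt n)) (hU : Module.finrank ℝ U + 2 = n + 1) :
    ∃ e₁ e₂, IsFrame U e₁ e₂ := by
  have h2 : Module.finrank ℝ Uᗮ = 2 := by
    have := Submodule.finrank_add_finrank_orthogonal U
    rw [finrank_euclideanSpace_fin] at this
    omega
  let e : OrthonormalBasis (Fin 2) ℝ Uᗮ := (stdOrthonormalBasis ℝ Uᗮ).reindex (finCongr h2)
  have ho := e.orthonormal
  refine ⟨e 0, e 1, ?_, ?_, ?_, (e 0).2, (e 1).2, fun y hy => ?_⟩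
  · exact (inner_self_eq_one_of_norm_eq_one (𝕜 := ℝ) (ho.1 0) :)
  · exact (inner_self_eq_one_of_norm_eq_one (𝕜 := ℝ) (ho.1 1) :)
  · exact (ho.2 (show (0 : Fin 2) ≠ 1 by decide) :)
  · have h := e.sum_repr' ⟨y, hy⟩
    rw [Fin.sum_univ_two] at h
    exact (congrArg Subtype.val h).symm

namespace IsFrame

variable {n : ℕ} {U : Submodule ℝ (Pt n)} {e₁ e₂ : Pt n}

theorem inner_21 (h : IsFrame U e₁ e₂) : inner ℝ e₂ e₁ = 0 := by
  rw [real_inner_comm, h.inner_12]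

theorem dir_mem (h : IsFrame U e₁ e₂) (t : ℝ) : circleDir e₁ e₂ t ∈ Uᗮ :=
  add_mem (Submodule.smul_mem _ _ h.mem_1) (Submodule.smul_mem _ _ h.mem_2)

theorem tan_mem (h : IsFrame U e₁ e₂) (t : ℝ) : circleTan e₁ e₂ t ∈ Uᗮ :=
  add_mem (Submodule.smul_mem _ _ h.mem_1) (Submodule.smul_mem _ _ h.mem_2)

theorem norm_dir (h : IsFrame U e₁ e₂) (t : ℝ) : ‖circleDir e₁ e₂ t‖ = 1 := by
  rw [← sq_eq_sq₀ (norm_nonneg _) zero_le_one, ← real_inner_self_eq_norm_sq]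
  simp only [circleDir, inner_add_left, inner_add_right, inner_smul_left, inner_smul_right,
    h.inner_11, h.inner_12, h.inner_21, h.inner_22, conj_trivial]
  linarith [Real.sin_sq_add_cos_sq t]

theorem norm_tan (h : IsFrame U e₁ e₂) (t : ℝ) : ‖circleTan e₁ e₂ t‖ = 1 := by
  rw [← sq_eq_sq₀ (norm_nonneg _) zero_le_one, ← real_inner_self_eq_norm_sq]
  simp only [circleTan, inner_add_left, inner_add_right, inner_smul_left, inner_smul_right,
    h.inner_11, h.inner_12, h.inner_21, h.inner_22, conj_trivial]
  linarith [Real.sin_sq_add_cos_sq t]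

theorem inner_tan_dir (h : IsFrame U e₁ e₂) (t : ℝ) :
    inner ℝ (circleTan e₁ e₂ t) (circleDir e₁ e₂ t) = 0 := by
  simp only [circleTan, circleDir, inner_add_left, inner_add_right, inner_smul_left,
    inner_smul_right, h.inner_11, h.inner_12, h.inner_21, h.inner_22, conj_trivial]
  ring

theorem exists_polar (h : IsFrame U e₁ e₂) {y : Pt n} (hy : y ∈ Uᗮ) (hy0 : y ≠ 0) :
    ∃ ρ θ : ℝ, 0 < ρ ∧ y = ρ • circleDir e₁ e₂ θ := by
  set z : ℂ := ⟨inner ℝ e₁ y, inner ℝ e₂ y⟩ with hz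
  have hz0 : z ≠ 0 := fun h0 => hy0 (by
    have h1 : (inner ℝ e₁ y : ℝ) = 0 := congrArg Complex.re h0
    have h2 : (inner ℝ e₂ y : ℝ) = 0 := congrArg Complex.im h0
    rw [h.eq_of_mem y hy, h1, h2, zero_smul, zero_smul, add_zero])
  refine ⟨‖z‖, z.arg, norm_pos_iff.2 hz0, ?_⟩
  rw [circleDir, smul_add, smul_smul, smul_smul, Complex.norm_mul_cos_arg,
    Complex.norm_mul_sin_arg]
  exact h.eq_of_mem y hy

theorem eq_add_of_dir_eq (h : IsFrame U e₁ e₂) {t θ : ℝ}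
    (heq : circleDir e₁ e₂ t = circleDir e₁ e₂ θ) : ∃ m : ℤ, t = θ + m * (2 * Real.pi) := by
  have hcos : ∀ t, inner ℝ e₁ (circleDir e₁ e₂ t) = Real.cos t := fun t => by
    rw [circleDir, inner_add_right, inner_smul_right, inner_smul_right, h.inner_11, h.inner_12]
    ring
  have hsin : ∀ t, inner ℝ e₂ (circleDir e₁ e₂ t) = Real.sin t := fun t => by
    rw [circleDir, inner_add_right, inner_smul_right, inner_smul_right, h.inner_21, h.inner_22]
    ring
  have h1 := Real.Angle.cos_sin_inj (θ := t) (ψ := θ) (by rw [← hcos, ← hcos, heq])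
    (by rw [← hsin, ← hsin, heq])
  obtain ⟨m, hm⟩ := Real.Angle.angle_eq_iff_two_pi_dvd_sub.1 h1
  exact ⟨m, by linarith⟩

end IsFrame

/-! ### Facets of a simplex -/

open Classical in
/-- The orientation sign with which the ordered tuple `F` occurs as a facet of the simplex `p`; it
vanishes if `F` is not a facet of `p`. -/
def facetSign {n : ℕ} (p : Fin (n + 1) → Pt n) (F : Fin n → Pt n) : ℝ :=
  ∑ b : Fin (n + 1), (-1) ^ (b : ℕ) * ∑ π : Equiv.Perm (Fin n),
    ((Equiv.Perm.sign π : ℤ) : ℝ) * if p ∘ b.succAbove ∘ π = F then 1 else 0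

theorem facetSign_eq {n : ℕ} {p : Fin (n + 1) → Pt n} (hp : Function.Injective p)
    {F : Fin n → Pt n} {b : Fin (n + 1)} {π : Equiv.Perm (Fin n)}
    (h : p ∘ b.succAbove ∘ π = F) :
    facetSign p F = (-1) ^ (b : ℕ) * ((Equiv.Perm.sign π : ℤ) : ℝ) := by
  have huniq : ∀ b' (π' : Equiv.Perm (Fin n)), p ∘ b'.succAbove ∘ π' = F → b' = b ∧ π' = π := by
    intro b' π' h'
    have h1 : b'.succAbove ∘ π' = b.succAbove ∘ π := hp.comp_left (by simpa using h'.trans h.symm)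
    have hb : b' = b := by
      have := congrArg Set.range h1
      rw [Set.range_comp, Set.range_comp, π'.range_eq_univ, π.range_eq_univ, Set.image_univ,
        Set.image_univ, Fin.range_succAbove, Fin.range_succAbove, compl_inj_iff] at this
      exact Set.singleton_eq_singleton_iff.1 this
    subst hb
    exact ⟨rfl, Equiv.ext fun k => Fin.succAbove_right_injective (congrFun h1 k)⟩
  rw [facetSign, Finset.sum_eq_single b]
  · rw [Finset.sum_eq_single π]
    · simp [h]
    · intro π' _ hne
      rw [if_neg fun h' => hne (huniq b π' h').2, mul_zero]
    · simp
  · intro b' _ hne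
    rw [Finset.sum_eq_zero, mul_zero]
    intro π' _
    rw [if_neg fun h' => hne (huniq b' π' h').1, mul_zero]
  · simp

theorem facetSign_eq_zero {n : ℕ} {p : Fin (n + 1) → Pt n} {F : Fin n → Pt n}
    (h : ∀ (b : Fin (n + 1)) (π : Equiv.Perm (Fin n)), p ∘ b.succAbove ∘ π ≠ F) :
    facetSign p F = 0 := by
  refine Finset.sum_eq_zero fun b _ => ?_
  rw [Finset.sum_eq_zero, mul_zero]
  intro π _
  rw [if_neg (h b π), mul_zero]

theorem exists_facet_of_subset_range {n : ℕ} {p : Fin (n + 1) → Pt n} {F : Fin n → Pt n}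
    (hF : Function.Injective F) (h : ∀ k, F k ∈ Set.range p) :
    ∃ (b : Fin (n + 1)) (π : Equiv.Perm (Fin n)), p ∘ b.succAbove ∘ π = F := by
  choose g hg using h
  have hginj : Function.Injective g := fun k l hkl => hF (by rw [← hg k, ← hg l, hkl])
  obtain ⟨b, hb⟩ : ∃ b, ∀ k, g k ≠ b := by
    by_contra! hall
    have := Fintype.card_le_of_surjective g hall
    simp at this
  choose z hz using fun k => Fin.exists_succAbove_eq (hb k)
  have hzinj : Function.Injective z := fun k l hkl => hginj (by rw [← hz k, ← hz l, hkl])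
  refine ⟨b, Equiv.ofBijective z (Finite.injective_iff_bijective.1 hzinj), ?_⟩
  ext1 k
  rw [← hg k, ← hz k]
  rfl

theorem sum_smul_mem_vectorSpan {n m : ℕ} (F : Fin m → Pt n) {z : Fin m → ℝ}
    (hz : ∑ k, z k = 0) : ∑ k, z k • F k ∈ vectorSpan ℝ (Set.range F) := by
  rw [← Finset.univ.weightedVSub_eq_linear_combination hz]
  exact weightedVSub_mem_vectorSpan hz F

theorem exists_weights_of_mem_vectorSpan {n m : ℕ} {F : Fin m → Pt n} {f : Pt n}
    (hf : f ∈ vectorSpan ℝ (Set.range F)) :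
    ∃ z : Fin m → ℝ, ∑ k, z k = 0 ∧ f = ∑ k, z k • F k := by
  classical
  obtain ⟨s, w, hw, rfl⟩ := (mem_vectorSpan_iff_eq_weightedVSub ℝ).1 hf
  refine ⟨fun k => if k ∈ s then w k else 0, ?_, ?_⟩
  · rw [Finset.sum_ite_mem, Finset.univ_inter, hw]
  · rw [s.weightedVSub_eq_linear_combination hw]
    simp [ite_smul, Finset.sum_ite_mem]

theorem sum_facet {n : ℕ} {p : Fin (n + 1) → Pt n} {F : Fin n → Pt n} {b : Fin (n + 1)}
    {π : Equiv.Perm (Fin n)} (h : p ∘ b.succAbove ∘ π = F) (w : Fin (n + 1) → ℝ) :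
    ∑ a, w a • p a = w b • p b + ∑ k, w (b.succAbove (π k)) • F k := by
  rw [Fin.sum_univ_succAbove _ b, ← h, ← Equiv.sum_comp π]
  rfl

/-- The barycentre of a facet. -/
def barycentre {n : ℕ} (F : Fin n → Pt n) : Pt n := ∑ k, (n : ℝ)⁻¹ • F k

/-- The homogeneous determinant of two vectors and the vertices of the facet `F`. -/
def facetDet {n : ℕ} (F : Fin n → Pt n) (v w : ℝ × Pt n) : ℝ :=
  homDet n (Matrix.vecCons v (Matrix.vecCons w fun k => (1, F k)))

theorem facetDet_eq_curryLeft {n : ℕ} (F : Fin n → Pt n) (v w : ℝ × Pt n) :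
    facetDet F v w = ((homDet n).curryLeft v).curryLeft w fun k => (1, F k) := rfl

theorem facetDet_self {n : ℕ} (F : Fin n → Pt n) (v : ℝ × Pt n) : facetDet F v v = 0 :=
  (homDet n).map_eq_zero_of_eq _ (i := 0) (j := 1) (by simp) (by simp)

theorem facetDet_swap {n : ℕ} (F : Fin n → Pt n) (v w : ℝ × Pt n) :
    facetDet F v w = -facetDet F w v := by
  have h := facetDet_self F (v + w)
  have h1 := facetDet_self F v
  have h2 := facetDet_self F w
  simp only [facetDet_eq_curryLeft, map_add, AlternatingMap.add_apply,
    AlternatingMap.curryLeft_add, LinearMap.add_apply] at h h1 h2 ⊢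
  linarith

theorem facetDet_vertex {n : ℕ} (F : Fin n → Pt n) (v : ℝ × Pt n) (k : Fin n) :
    facetDet F v (1, F k) = 0 :=
  (homDet n).map_eq_zero_of_eq _ (i := 1) (j := k.succ.succ) (by simp)
    (by simp [Fin.ext_iff])

/-- Moving the vertex opposite to the facet to the front and sorting the others costs (-1)^b sign π,
the orientation with which F occurs in p. -/
theorem inner_areaNormal_facet {n : ℕ} {p : Fin (n + 1) → Pt n} {F : Fin n → Pt n}
    {b : Fin (n + 1)} {π : Equiv.Perm (Fin n)} (h : p ∘ b.succAbove ∘ π = F) (v : Pt n) :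
    inner ℝ (areaNormal p) v = (-1) ^ (n + 1) *
      ((-1) ^ (b : ℕ) * ((Equiv.Perm.sign π : ℤ) : ℝ) * facetDet F (0, v) (1, p b)) := by
  rw [inner_areaNormal_eq_homDet]
  congr 1
  have h1 : (fun a => ((1 : ℝ), p a)) =
      b.insertNth (1, p b) ((fun k => ((1 : ℝ), F k)) ∘ π.symm) := by
    ext1 a
    refine b.succAboveCases ?_ (fun a => ?_) a
    · simp
    · simp only [Fin.insertNth_apply_succAbove, ← h]
      simp
  have h2 : homDet n (Matrix.vecCons (0, v) fun a => (1, p a)) =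
      (homDet n).curryLeft (0, v) fun a => (1, p a) := rfl
  rw [h2, h1, AlternatingMap.map_insertNth]
  have h3 : ∀ G : Fin n → ℝ × Pt n, (homDet n).curryLeft (0, v) (Matrix.vecCons (1, p b) G) =
      ((homDet n).curryLeft (0, v)).curryLeft (1, p b) G := fun G => rfl
  rw [h3, AlternatingMap.map_perm, facetDet_eq_curryLeft]
  simp [Units.smul_def, mul_assoc]

/-- Modulo the facet, p b is ρ times the direction θ, and the pair (tangent, direction) has
determinant -1 with respect to (e₁, e₂). Apart from ρ > 0 in the applications and the orientation
sign, only data common to all cells at the facet remain. -/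
theorem inner_areaNormal_circleTan {n : ℕ} {p : Fin (n + 1) → Pt n} {F : Fin n → Pt n}
    {b : Fin (n + 1)} {π : Equiv.Perm (Fin n)} (h : p ∘ b.succAbove ∘ π = F)
    {e₁ e₂ : Pt n} {ρ θ : ℝ} {z : Fin n → ℝ} (hz : ∑ k, z k = 1)
    (hpb : p b = ∑ k, z k • F k + ρ • circleDir e₁ e₂ θ) :
    inner ℝ (areaNormal p) (circleTan e₁ e₂ θ) = (-1) ^ (b : ℕ) *
      ((Equiv.Perm.sign π : ℤ) : ℝ) * ρ * ((-1) ^ n * facetDet F (0, e₁) (0, e₂)) := by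
  have h1 : ((1 : ℝ), p b) = ∑ k, z k • ((1 : ℝ), F k) +
      ((ρ * Real.cos θ) • ((0 : ℝ), e₁) + (ρ * Real.sin θ) • ((0 : ℝ), e₂)) := by
    ext1
    · simp [Prod.fst_sum, hz]
    · simp [Prod.snd_sum, hpb, circleDir, smul_smul]
  have h2 : ((0 : ℝ), circleTan e₁ e₂ θ) =
      (-Real.sin θ) • ((0 : ℝ), e₁) + Real.cos θ • ((0 : ℝ), e₂) := by
    ext1 <;> simp [circleTan]
  have hadd : ∀ u v w, facetDet F u (v + w) = facetDet F u v + facetDet F u w := fun u v w => by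
    simp [facetDet_eq_curryLeft]
  have hsmul : ∀ u (c : ℝ) w, facetDet F u (c • w) = c * facetDet F u w := fun u c w => by
    simp [facetDet_eq_curryLeft]
  have hsum : ∀ u, facetDet F u (∑ k, z k • ((1 : ℝ), F k)) = 0 := fun u => by
    let L : ℝ × Pt n →ₗ[ℝ] ℝ :=
      { toFun := facetDet F u, map_add' := hadd u, map_smul' := hsmul u }
    refine (map_sum L _ _).trans ?_
    exact Finset.sum_eq_zero fun k _ =>
      (hsmul u _ _).trans (by rw [facetDet_vertex, mul_zero])
  rw [inner_areaNormal_facet h, h1, h2, hadd, hsum, zero_add, facetDet_swap, hadd, hsmul, hsmul,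
    facetDet_swap F _ (0, e₁), facetDet_swap F _ (0, e₂), hadd, hadd, hsmul, hsmul, hsmul, hsmul,
    facetDet_self, facetDet_self, facetDet_swap F (0, e₂) (0, e₁)]
  linear_combination (-1) ^ (b : ℕ) * ((Equiv.Perm.sign π : ℤ) : ℝ) * ρ *
    ((-1) ^ n * facetDet F (0, e₁) (0, e₂)) * Real.sin_sq_add_cos_sq θ

end Stefan

end

noncomputable section

namespace Stefan

open Filter Topology

/-! ### A simplex seen from one of its facets. -/

section Facet

variable {n : ℕ} {p : Fin (n + 1) → Pt n} {F : Fin n → Pt n} {b : Fin (n + 1)}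
  {π : Equiv.Perm (Fin n)} {e₁ e₂ : Pt n}

theorem sum_inv_card (hn : n ≠ 0) : ∑ _k : Fin n, (n : ℝ)⁻¹ = 1 := by
  have : (n : ℝ) ≠ 0 := Nat.cast_ne_zero.2 hn
  simp [this]

/-- ρ and θ are polar coordinates of the component of p b - `barycentre F` orthogonal to the facet.
If it were zero, p b would be an affine combination of the other vertices. -/
theorem exists_polar_vertex (hn : n ≠ 0) (hp : AffineIndependent ℝ p)
    (h : p ∘ b.succAbove ∘ π = F) (hf : IsFrame (vectorSpan ℝ (Set.range F)) e₁ e₂) :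
    ∃ (ρ θ : ℝ) (z : Fin n → ℝ), 0 < ρ ∧ ∑ k, z k = 1 ∧
      p b = ∑ k, z k • F k + ρ • circleDir e₁ e₂ θ := by
  obtain ⟨f, hfU, y, hy, hfy⟩ := Submodule.exists_add_mem_mem_orthogonal
    (K := vectorSpan ℝ (Set.range F)) (p b - barycentre F)
  obtain ⟨φ, hφ0, rfl⟩ := exists_weights_of_mem_vectorSpan hfU
  have hz : ∑ k, ((n : ℝ)⁻¹ + φ k) = 1 := by
    rw [Finset.sum_add_distrib, hφ0, sum_inv_card hn, add_zero]
  have hpb : p b = ∑ k, ((n : ℝ)⁻¹ + φ k) • F k + y := by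
    rw [eq_add_of_sub_eq hfy, barycentre]
    simp only [add_smul, Finset.sum_add_distrib]
    abel
  have hy0 : y ≠ 0 := by
    rintro rfl
    rw [add_zero] at hpb
    have h1 : (Pi.single b 1 : Fin (n + 1) → ℝ) =
        b.insertNth 0 (fun l => (n : ℝ)⁻¹ + φ (π.symm l)) := by
      refine weights_unique hp ?_ ?_
      · rw [Fin.sum_univ_succAbove _ b, Fin.sum_univ_succAbove _ b, ← Equiv.sum_comp π]
        simpa using hz.symm.trans (π.symm.sum_comp fun k => (n : ℝ)⁻¹ + φ k).symm
      · rw [sum_facet h, sum_facet h]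
        simp [hpb]
    have := congrFun h1 b
    simp at this
  obtain ⟨ρ, θ, hρ, rfl⟩ := hf.exists_polar hy hy0
  exact ⟨ρ, θ, _, hρ, hz, hpb⟩

/-- The weights are r / ρ at the vertex p b and 1 / n - (r / ρ) z on F; they are positive for small
r. -/
theorem eventually_mem_openSimplex (hn : n ≠ 0) (h : p ∘ b.succAbove ∘ π = F) {ρ θ : ℝ}
    {z : Fin n → ℝ} (hρ : 0 < ρ) (hz : ∑ k, z k = 1)
    (hpb : p b = ∑ k, z k • F k + ρ • circleDir e₁ e₂ θ) :
    ∀ᶠ r in 𝓝[>] (0 : ℝ), barycentre F + r • circleDir e₁ e₂ θ ∈ openSimplex p := by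
  have hpos : ∀ k, ∀ᶠ r in 𝓝[>] (0 : ℝ), 0 < (n : ℝ)⁻¹ - r / ρ * z k := fun k => by
    have hc : Tendsto (fun r : ℝ => (n : ℝ)⁻¹ - r / ρ * z k) (𝓝 0)
        (𝓝 ((n : ℝ)⁻¹ - 0 / ρ * z k)) := Continuous.tendsto (by fun_prop) 0
    refine (hc.eventually (lt_mem_nhds ?_)).filter_mono nhdsWithin_le_nhds
    have : (0 : ℝ) < n := Nat.cast_pos.2 (Nat.pos_of_ne_zero hn)
    simpa using this
  filter_upwards [Filter.eventually_all.2 hpos, self_mem_nhdsWithin] with r hr hr0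
  refine ⟨b.insertNth (r / ρ) (fun l => (n : ℝ)⁻¹ - r / ρ * z (π.symm l)), fun a => ?_, ?_, ?_⟩
  · refine b.succAboveCases ?_ (fun a => ?_) a
    · simpa using div_pos hr0 hρ
    · simpa using hr (π.symm a)
  · rw [Fin.sum_univ_succAbove _ b, ← Equiv.sum_comp π]
    simp only [Fin.insertNth_apply_same, Fin.insertNth_apply_succAbove, Equiv.symm_apply_apply]
    rw [Finset.sum_sub_distrib, ← Finset.mul_sum, hz, sum_inv_card hn]
    ring
  · rw [sum_facet h]
    simp only [Fin.insertNth_apply_same, Fin.insertNth_apply_succAbove, Equiv.symm_apply_apply]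
    rw [hpb, barycentre, smul_add, smul_smul, div_mul_cancel₀ _ hρ.ne']
    simp only [sub_smul, Finset.sum_sub_distrib, mul_smul, ← Finset.smul_sum]
    abel

/-- Orthogonally to the facet, membership says that r times the direction t is w b ρ times the
direction θ; both directions are unit vectors, so the nonnegative factors agree. -/
theorem circleDir_eq_of_mem (hn : n ≠ 0) (h : p ∘ b.succAbove ∘ π = F)
    (hf : IsFrame (vectorSpan ℝ (Set.range F)) e₁ e₂) {ρ θ : ℝ}
    {z : Fin n → ℝ} (hρ : 0 < ρ) (hz : ∑ k, z k = 1)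
    (hpb : p b = ∑ k, z k • F k + ρ • circleDir e₁ e₂ θ) {r t : ℝ} (hr : 0 < r)
    (hmem : barycentre F + r • circleDir e₁ e₂ t ∈ closedSimplex p) :
    circleDir e₁ e₂ t = circleDir e₁ e₂ θ := by
  obtain ⟨w, hw0, hw1, hw⟩ := mem_closedSimplex_iff.1 hmem
  rw [Fin.sum_univ_succAbove _ b, ← Equiv.sum_comp π] at hw1
  rw [sum_facet h, hpb] at hw
  have hdiff : r • circleDir e₁ e₂ t - (w b * ρ) • circleDir e₁ e₂ θ =
      ∑ k, (w (b.succAbove (π k)) + w b * z k - (n : ℝ)⁻¹) • F k := by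
    rw [eq_sub_of_add_eq' hw, barycentre]
    simp only [sub_smul, add_smul, Finset.sum_sub_distrib, Finset.sum_add_distrib, mul_smul,
      smul_add, ← Finset.smul_sum]
    abel
  have hU : r • circleDir e₁ e₂ t - (w b * ρ) • circleDir e₁ e₂ θ ∈
      vectorSpan ℝ (Set.range F) := by
    rw [hdiff]
    refine sum_smul_mem_vectorSpan F ?_
    rw [Finset.sum_sub_distrib, Finset.sum_add_distrib, ← Finset.mul_sum, hz, sum_inv_card hn]
    linarith
  have hU' := sub_mem (Submodule.smul_mem _ r (hf.dir_mem t))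
    (Submodule.smul_mem _ (w b * ρ) (hf.dir_mem θ))
  have h0 := sub_eq_zero.1 (inner_self_eq_zero.1 (Submodule.inner_right_of_mem_orthogonal hU hU'))
  have hnorm := congrArg norm h0
  rw [norm_smul, norm_smul, hf.norm_dir, hf.norm_dir, mul_one, mul_one, Real.norm_eq_abs,
    Real.norm_eq_abs, abs_of_pos hr, abs_of_nonneg (mul_nonneg (hw0 b) hρ.le)] at hnorm
  rw [← hnorm] at h0
  exact smul_right_injective _ hr.ne' h0

/-- The tangent of the circle at the angle of p b is orthogonal to all edges of the simplex, so its
product with the normal is nonzero, and this product contains `facetDet` as a factor. -/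
theorem facetDet_ne_zero (hn : n ≠ 0) (hp : AffineIndependent ℝ p) (h : p ∘ b.succAbove ∘ π = F)
    (hf : IsFrame (vectorSpan ℝ (Set.range F)) e₁ e₂) :
    facetDet F (0, e₁) (0, e₂) ≠ 0 := by
  obtain ⟨ρ, θ, z, hρ, hz, hpb⟩ := exists_polar_vertex hn hp h hf
  set v := circleTan e₁ e₂ θ with hv
  have hF : ∀ k l, inner ℝ v (F k) = inner ℝ v (F l) := fun k l => by
    have h1 := Submodule.inner_left_of_mem_orthogonal
      (vsub_mem_vectorSpan ℝ (Set.mem_range_self k) (Set.mem_range_self l)) (hf.tan_mem θ)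
    rw [vsub_eq_sub, inner_sub_right] at h1
    exact sub_eq_zero.1 h1
  have l : Fin n := ⟨0, Nat.pos_of_ne_zero hn⟩
  have hall : ∀ a, inner ℝ v (p a) = inner ℝ v (F l) := by
    intro a
    refine b.succAboveCases ?_ (fun a => ?_) a
    · rw [hpb, inner_add_right, inner_smul_right, hf.inner_tan_dir, mul_zero, add_zero, inner_sum]
      simp only [inner_smul_right, hF _ l]
      rw [← Finset.sum_mul, hz, one_mul]
    · rw [← hF (π.symm a) l, ← h]
      simp
  have hnot : v ∉ vectorSpan ℝ (Set.range p) := by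
    intro hmem
    have hle : vectorSpan ℝ (Set.range p) ≤ (Submodule.span ℝ {v})ᗮ := by
      refine Submodule.span_le.2 ?_
      rintro _ ⟨_, ⟨a, rfl⟩, _, ⟨a', rfl⟩, rfl⟩
      refine Submodule.mem_orthogonal_singleton_iff_inner_right.2 ?_
      simp only [vsub_eq_sub]
      rw [inner_sub_right, hall, hall, sub_self]
    have h1 := Submodule.mem_orthogonal_singleton_iff_inner_right.1 (hle hmem)
    have h2 := hf.norm_tan θ
    rw [← hv, inner_self_eq_zero.1 h1, norm_zero] at h2
    exact zero_ne_one h2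
  intro h0
  refine inner_areaNormal_ne_zero hp hnot ?_
  rw [inner_areaNormal_circleTan h hz hpb, h0, mul_zero, mul_zero]

end Facet

/-! ### The cluster weighted by the jumps is a cycle. -/

namespace ClusterMesh

variable {n : ℕ} {M : ClusterMesh n} {Ω : Set (Pt n)} {q : M.Config}
  {Ph : Fin M.numPhase → Set (Pt n)}

theorem barycentre_mem {p : Fin (n + 1) → Pt n} {F : Fin n → Pt n} {b : Fin (n + 1)}
    {π : Equiv.Perm (Fin n)} (hn : n ≠ 0) (h : p ∘ b.succAbove ∘ π = F) :
    ∃ w : Fin (n + 1) → ℝ, (∀ a, 0 ≤ w a) ∧ ∑ a, w a = 1 ∧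
      (∀ k, w (b.succAbove (π k)) ≠ 0) ∧ barycentre F = ∑ a, w a • p a := by
  have hn' : (n : ℝ) ≠ 0 := Nat.cast_ne_zero.2 hn
  refine ⟨b.insertNth 0 fun _ => (n : ℝ)⁻¹, fun a => ?_, ?_, fun k => ?_, ?_⟩
  · refine b.succAboveCases ?_ (fun a => ?_) a <;> simp
  · rw [Fin.sum_univ_succAbove _ b]
    simp [hn']
  · simpa using hn
  · rw [sum_facet h]
    simp [barycentre]

/-- The points where a small circle around a facet of the cluster meets a given simplex. -/
theorem IsCluster.exists_circle_cell (h : M.IsCluster Ω q Ph) (hn : n ≠ 0) {F : Fin n → Pt n}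
    {c₀ : M.Cell} {b₀ : Fin (n + 1)} {π₀ : Equiv.Perm (Fin n)}
    (h₀ : M.cell q c₀ ∘ b₀.succAbove ∘ π₀ = F) {e₁ e₂ : Pt n}
    (hf : IsFrame (vectorSpan ℝ (Set.range F)) e₁ e₂) (c : M.Cell) :
    ∃ θ : ℝ, ∀ᶠ r in 𝓝[>] (0 : ℝ), ∀ t,
      (barycentre F + r • circleDir e₁ e₂ t ∈ closedSimplex (M.cell q c) →
        (∃ m : ℤ, t = θ + m * (2 * Real.pi)) ∧
        barycentre F + r • circleDir e₁ e₂ t ∈ openSimplex (M.cell q c) ∧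
        inner ℝ (areaNormal (M.cell q c)) (r • circleTan e₁ e₂ t) ≠ 0 ∧
        (SignType.sign (inner ℝ (areaNormal (M.cell q c)) (r • circleTan e₁ e₂ t)) : ℝ) =
          facetSign (M.cell q c) F *
            (SignType.sign ((-1) ^ n * facetDet F (0, e₁) (0, e₂)) : ℝ)) ∧
      ((∃ m : ℤ, t = θ + m * (2 * Real.pi)) →
        barycentre F + r • circleDir e₁ e₂ t ∈ closedSimplex (M.cell q c) ∨
          facetSign (M.cell q c) F = 0) := by
  by_cases hc : ∃ (b : Fin (n + 1)) (π : Equiv.Perm (Fin n)), M.cell q c ∘ b.succAbove ∘ π = F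
  · obtain ⟨b, π, hF⟩ := hc
    have hp := h.affineIndependent c
    obtain ⟨ρ, θ, z, hρ, hz, hpb⟩ := exists_polar_vertex hn hp hF hf
    refine ⟨θ, ?_⟩
    filter_upwards [eventually_mem_openSimplex hn hF hρ hz hpb, self_mem_nhdsWithin]
      with r hr hr0 t
    constructor
    · intro hmem
      have hdir := circleDir_eq_of_mem hn hF hf hρ hz hpb hr0 hmem
      obtain ⟨m, hm⟩ := hf.eq_add_of_dir_eq hdir
      have hin : inner ℝ (areaNormal (M.cell q c)) (r • circleTan e₁ e₂ t) =
          r * ρ * (((-1) ^ (b : ℕ) * ((Equiv.Perm.sign π : ℤ) : ℝ)) *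
            ((-1) ^ n * facetDet F (0, e₁) (0, e₂))) := by
        rw [hm, circleTan_add, inner_smul_right, inner_areaNormal_circleTan hF hz hpb]
        ring
      refine ⟨⟨m, hm⟩, hdir ▸ hr, ?_, ?_⟩
      · rw [hin]
        refine mul_ne_zero (mul_pos hr0 hρ).ne' (mul_ne_zero (mul_ne_zero (by simp) ?_)
          (mul_ne_zero (by simp) (facetDet_ne_zero hn hp hF hf)))
        simp
      · rw [hin, facetSign_eq hp.injective hF, sign_mul, sign_pos (mul_pos hr0 hρ), one_mul,
          sign_mul]
        have : (SignType.sign ((-1) ^ (b : ℕ) * ((Equiv.Perm.sign π : ℤ) : ℝ)) : ℝ) =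
            (-1) ^ (b : ℕ) * ((Equiv.Perm.sign π : ℤ) : ℝ) := by
          rcases neg_one_pow_eq_or ℝ (b : ℕ) with h1 | h1 <;>
            rcases Int.units_eq_one_or (Equiv.Perm.sign π) with h2 | h2 <;>
            simp [h1, h2]
        rw [SignType.coe_mul, this]
    · rintro ⟨m, rfl⟩
      left
      rw [circleDir_add]
      exact openSimplex_subset_closedSimplex _ hr
  -- F is not a facet of c, and the angle 0 is a dummy, harmless because `facetSign` vanishes. By
  -- conformity the barycentre of F is not in c, so small circles miss c.
  · refine ⟨0, ?_⟩
    have hzero : facetSign (M.cell q c) F = 0 :=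
      facetSign_eq_zero fun b π hb => hc ⟨b, π, hb⟩
    have hFinj : Function.Injective F := by
      rw [← h₀]
      exact (h.affineIndependent c₀).injective.comp
        (Fin.succAbove_right_injective.comp π₀.injective)
    have hnot : barycentre F ∉ closedSimplex (M.cell q c) := by
      intro hmem
      obtain ⟨w, hw0, hw1, hwk, hw⟩ := barycentre_mem hn h₀
      have hmem₀ : barycentre F ∈ closedSimplex (M.cell q c₀) :=
        mem_closedSimplex_iff.2 ⟨w, hw0, hw1, hw⟩
      have hint : barycentre F ∈
          convexHull ℝ (Set.range (M.cell q c₀) ∩ Set.range (M.cell q c)) :=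
        (h.conforming c₀.1 c₀.2 c.1 c.2) ▸ ⟨hmem₀, hmem⟩
      rw [hw] at hint
      refine hc (exists_facet_of_subset_range hFinj fun k => ?_)
      have := (mem_of_mem_convexHull_of_pos (h.affineIndependent c₀) Set.inter_subset_left hw1
        hint (hwk k)).2
      rw [← h₀]
      exact this
    obtain ⟨ε, hε, hball⟩ := Metric.isOpen_iff.1
      (isClosed_closedSimplex (M.cell q c)).isOpen_compl _ hnot
    filter_upwards [Ioo_mem_nhdsGT hε] with r hr t
    refine ⟨fun hmem => absurd hmem (hball ?_), fun _ => Or.inr hzero⟩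
    rw [mem_ball_iff_norm, add_sub_cancel_left, norm_smul, hf.norm_dir, mul_one,
      Real.norm_eq_abs, abs_of_pos hr.1]
    exact hr.2

/-- The sum of the jumps over the simplices that meet in a facet, counted with orientation,
vanishes. -/
theorem IsCluster.sum_jump_mul_facetSign (h : M.IsCluster Ω q Ph) (hn : n ≠ 0) (hΩ : IsOpen Ω)
    (β : Fin M.numPhase → ℝ) (F : Fin n → Pt n) :
    ∑ c : M.Cell, M.jump β c.1 * facetSign (M.cell q c) F = 0 := by
  classical
  by_cases hex : ∃ (c : M.Cell) (b : Fin (n + 1)) (π : Equiv.Perm (Fin n)),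
      M.cell q c ∘ b.succAbove ∘ π = F
  swap
  · push Not at hex
    exact Finset.sum_eq_zero fun c _ => by rw [facetSign_eq_zero (hex c), mul_zero]
  obtain ⟨c₀, b₀, π₀, h₀⟩ := hex
  have hFai : AffineIndependent ℝ F := by
    rw [← h₀]
    exact (h.affineIndependent c₀).comp_embedding
      (π₀.toEmbedding.trans ⟨b₀.succAbove, Fin.succAbove_right_injective⟩)
  obtain ⟨e₁, e₂, hf⟩ := exists_isFrame (vectorSpan ℝ (Set.range F)) (by
    have := hFai.finrank_vectorSpan (n := n - 1) (by simp; omega)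
    omega)
  choose θ hθ using h.exists_circle_cell hn h₀ hf
  have hmemΩ : barycentre F ∈ Ω := by
    obtain ⟨w, hw0, hw1, -, hw⟩ := barycentre_mem hn h₀
    exact h.subset_domain (closedSimplex_subset_cluster q c₀
      (mem_closedSimplex_iff.2 ⟨w, hw0, hw1, hw⟩))
  obtain ⟨ε, hε, hball⟩ := Metric.isOpen_iff.1 hΩ _ hmemΩ
  obtain ⟨r, hr, hr0, hrε⟩ := ((Filter.eventually_all.2 hθ).and (Ioo_mem_nhdsGT hε)).exists
  set γ : ℝ → Pt n := fun t => barycentre F + r • circleDir e₁ e₂ t with hγ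
  have hγΩ : ∀ t, γ t ∈ Ω := fun t => hball (by
    rw [mem_ball_iff_norm, hγ]
    simp only
    rw [add_sub_cancel_left, norm_smul, hf.norm_dir, mul_one, Real.norm_eq_abs, abs_of_pos hr0]
    exact hrε)
  set σ : ℝ := (SignType.sign ((-1) ^ n * facetDet F (0, e₁) (0, e₂)) : ℝ) with hσ
  have hσ0 : σ ≠ 0 := by
    have h1 : (-1 : ℝ) ^ n * facetDet F (0, e₁) (0, e₂) ≠ 0 :=
      mul_ne_zero (by simp) (facetDet_ne_zero hn (h.affineIndependent c₀) h₀ hf)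
    rcases lt_or_gt_of_ne h1 with h2 | h2
    · rw [hσ, sign_neg h2]; simp
    · rw [hσ, sign_pos h2]; simp
  -- Each floor counts the passages through one cell. Weighted with the jump and the crossing sign,
  -- the counters have the same jumps as the phase function on the circle.
  obtain ⟨K, hK⟩ := exists_eventually_eq_of_punctured (h := fun s => M.phaseFun β Ph (γ s) -
      ∑ c : M.Cell, M.jump β c.1 * (facetSign (M.cell q c) F * σ) *
        (⌊(s - θ c) / (2 * Real.pi)⌋ : ℝ)) fun t => by
    obtain ⟨k, hk⟩ := h.eventually_phaseFun_eq hΩ β (hasDerivAt_circle e₁ e₂ (barycentre F) r t)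
      (hγΩ t) fun c hc => ⟨((hr c t).1 hc).2.1, ((hr c t).1 hc).2.2.1⟩
    choose k' hk' using fun c => exists_floor_eventually (θ c) t
    refine ⟨k - ∑ c : M.Cell, M.jump β c.1 * (facetSign (M.cell q c) F * σ) * k' c, ?_⟩
    filter_upwards [hk, Filter.eventually_all.2 hk'] with s hs hs'
    rw [hγ]
    simp only [hs, hs']
    rw [add_sub_assoc, sub_eq_add_neg k, add_right_inj, ← Finset.sum_sub_distrib,
      ← Finset.sum_neg_distrib]
    refine Finset.sum_congr rfl fun c _ => ?_
    by_cases hc : barycentre F + r • circleDir e₁ e₂ t ∈ closedSimplex (M.cell q c)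
    · obtain ⟨hm, -, -, hsg⟩ := (hr c t).1 hc
      rw [if_pos hc, Set.indicator_of_mem (by exact hm), hsg, Pi.one_apply]
      ring
    · rw [if_neg hc]
      by_cases hm : ∃ m : ℤ, t = θ c + m * (2 * Real.pi)
      · rw [((hr c t).2 hm).resolve_left hc]
        ring
      · rw [Set.indicator_of_notMem (by exact hm)]
        ring
  -- A full turn restores the phase function and raises every counter by one, so the sum of all
  -- weights is zero.
  have hshift : Tendsto (fun s : ℝ => s + 2 * Real.pi) (𝓝[≠] 0) (𝓝[≠] (0 + 2 * Real.pi)) := by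
    refine tendsto_nhdsWithin_iff.2 ⟨Tendsto.mono_left (Continuous.tendsto (by fun_prop) 0)
      nhdsWithin_le_nhds, ?_⟩
    filter_upwards [self_mem_nhdsWithin] with s hs heq
    exact hs (add_right_cancel heq)
  obtain ⟨s, hs, hs'⟩ := ((hK 0).and (hshift.eventually (hK _))).exists
  have hper : γ (s + 2 * Real.pi) = γ s := by
    have := circleDir_add e₁ e₂ s 1
    rw [Int.cast_one, one_mul] at this
    rw [hγ]
    simp only [this]
  have hfl : ∀ c, (⌊(s + 2 * Real.pi - θ c) / (2 * Real.pi)⌋ : ℝ) =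
      (⌊(s - θ c) / (2 * Real.pi)⌋ : ℝ) + 1 := fun c => by
    have : (s + 2 * Real.pi - θ c) / (2 * Real.pi) = (s - θ c) / (2 * Real.pi) + 1 := by
      have := Real.two_pi_pos.ne'
      field_simp
      ring
    rw [this, Int.floor_add_one]
    push_cast
    rfl
  simp only [hper, hfl, mul_add, mul_one, Finset.sum_add_distrib] at hs'
  have hfin : (∑ c : M.Cell, M.jump β c.1 * facetSign (M.cell q c) F) * σ = 0 := by
    rw [Finset.sum_mul]
    simp only [mul_assoc] at hs hs' ⊢
    linarith
  exact (mul_eq_zero.1 hfin).resolve_right hσ0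

/-- The weighted simplicial chain of a cluster is a cycle: alternating functions of the facets sum
up to zero. -/
theorem IsCluster.sum_facets_eq_zero (h : M.IsCluster Ω q Ph) (hn : n ≠ 0) (hΩ : IsOpen Ω)
    (β : Fin M.numPhase → ℝ) {Φ : (Fin n → Pt n) → ℝ}
    (hΦ : ∀ (F : Fin n → Pt n) (π : Equiv.Perm (Fin n)),
      Φ (F ∘ π) = ((Equiv.Perm.sign π : ℤ) : ℝ) * Φ F) :
    ∑ c : M.Cell, M.jump β c.1 *
      ∑ b : Fin (n + 1), (-1) ^ (b : ℕ) * Φ (M.cell q c ∘ b.succAbove) = 0 := by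
  classical
  set S : Finset (Fin n → Pt n) := Finset.univ.image
    fun x : M.Cell × Fin (n + 1) × Equiv.Perm (Fin n) => M.cell q x.1 ∘ x.2.1.succAbove ∘ x.2.2
    with hS
  -- S contains every facet in all its orderings. Since Φ is alternating, each ordering contributes
  -- the same, whence the factor n!.
  have hΦ' : ∀ (c : M.Cell) (b : Fin (n + 1)),
      (n.factorial : ℝ) * Φ (M.cell q c ∘ b.succAbove) =
        ∑ F ∈ S, Φ F * ∑ π : Equiv.Perm (Fin n), ((Equiv.Perm.sign π : ℤ) : ℝ) *
          if M.cell q c ∘ b.succAbove ∘ π = F then 1 else 0 := by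
    intro c b
    simp only [Finset.mul_sum]
    rw [Finset.sum_comm]
    have hterm : ∀ π : Equiv.Perm (Fin n), ∑ F ∈ S, Φ F * (((Equiv.Perm.sign π : ℤ) : ℝ) *
        if M.cell q c ∘ b.succAbove ∘ π = F then 1 else 0) = Φ (M.cell q c ∘ b.succAbove) := by
      intro π
      rw [Finset.sum_eq_single (M.cell q c ∘ b.succAbove ∘ π)]
      · rw [if_pos rfl, ← Function.comp_assoc, hΦ]
        rcases Int.units_eq_one_or (Equiv.Perm.sign π) with h2 | h2 <;> simp [h2]
      · intro F _ hF
        rw [if_neg hF.symm, mul_zero, mul_zero]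
      · intro hnot
        exact absurd (Finset.mem_image.2 ⟨(c, b, π), Finset.mem_univ _, rfl⟩) hnot
    rw [Finset.sum_congr rfl fun π _ => hterm π, Finset.sum_const, Finset.card_univ,
      Fintype.card_perm, Fintype.card_fin, nsmul_eq_mul]
  have hmul : (n.factorial : ℝ) * ∑ c : M.Cell, M.jump β c.1 *
      ∑ b : Fin (n + 1), (-1) ^ (b : ℕ) * Φ (M.cell q c ∘ b.succAbove) =
      ∑ F ∈ S, Φ F * ∑ c : M.Cell, M.jump β c.1 * facetSign (M.cell q c) F := by
    simp only [Finset.mul_sum (s := (Finset.univ : Finset M.Cell))]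
    rw [Finset.sum_comm]
    refine Finset.sum_congr rfl fun c _ => ?_
    have : ∑ F ∈ S, Φ F * facetSign (M.cell q c) F =
        ∑ b : Fin (n + 1), (-1) ^ (b : ℕ) *
          ((n.factorial : ℝ) * Φ (M.cell q c ∘ b.succAbove)) := by
      simp only [hΦ', facetSign, Finset.mul_sum (s := (Finset.univ : Finset (Fin (n + 1)))),
        Finset.mul_sum (s := S)]
      rw [Finset.sum_comm]
      refine Finset.sum_congr rfl fun b _ => Finset.sum_congr rfl fun F _ => by ring
    have h2 : ∑ F ∈ S, Φ F * (M.jump β c.1 * facetSign (M.cell q c) F) =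
        M.jump β c.1 * ∑ F ∈ S, Φ F * facetSign (M.cell q c) F := by
      rw [Finset.mul_sum]
      exact Finset.sum_congr rfl fun F _ => by ring
    rw [h2, this, mul_left_comm, Finset.mul_sum]
    congr 1
    exact Finset.sum_congr rfl fun b _ => by ring
  rw [Finset.sum_eq_zero (s := S) fun F _ => by
    rw [h.sum_jump_mul_facetSign hn hΩ β F, mul_zero]] at hmul
  exact (mul_eq_zero.1 hmul).resolve_left (by positivity)

end ClusterMesh

end Stefan

end

noncomputable section

namespace Stefan

open Filter Topology MeasureTheory

/-! ### Integration of affine functions over the reference simplex -/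

/-- The affine symmetry of the reference simplex that exchanges its zeroth vertex with another
one. -/
def simplexFlip {n : ℕ} (a : Fin n) (s : Fin n → ℝ) : Fin n → ℝ :=
  Function.update s a (1 - ∑ b, s b)

/-- The linear part of `simplexFlip`. -/
def simplexFlipLin {n : ℕ} (a : Fin n) : (Fin n → ℝ) →ₗ[ℝ] (Fin n → ℝ) where
  toFun s := Function.update s a (-∑ b, s b)
  map_add' s t := by
    ext b
    by_cases h : b = a
    · subst h; simp [Finset.sum_add_distrib]; ring
    · simp [h]
  map_smul' c s := by
    ext b
    by_cases h : b = a
    · subst h; simp [Finset.mul_sum]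
    · simp [h]

theorem sum_update {n : ℕ} (s : Fin n → ℝ) (a : Fin n) (x : ℝ) :
    ∑ b, Function.update s a x b = x + (∑ b, s b - s a) := by
  rw [Finset.sum_update_of_mem (Finset.mem_univ a), ← Finset.sum_erase_eq_sub (Finset.mem_univ a),
    Finset.sdiff_singleton_eq_erase]

theorem simplexFlipLin_comp {n : ℕ} (a : Fin n) :
    (simplexFlipLin a) ∘ₗ (simplexFlipLin a) = LinearMap.id := by
  refine LinearMap.ext fun s => ?_
  simp only [simplexFlipLin, LinearMap.comp_apply, LinearMap.coe_mk, AddHom.coe_mk, sum_update,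
    LinearMap.id_apply, Function.update_idem]
  rw [Function.update_eq_self_iff]
  ring

theorem simplexFlip_involutive {n : ℕ} (a : Fin n) : Function.Involutive (simplexFlip a) := by
  intro s
  simp only [simplexFlip, sum_update, Function.update_idem]
  rw [Function.update_eq_self_iff]
  ring

theorem simplexFlip_eq {n : ℕ} (a : Fin n) (s : Fin n → ℝ) :
    simplexFlip a s = Pi.single a 1 + simplexFlipLin a s := by
  ext b
  by_cases h : b = a
  · subst h; simp [simplexFlip, simplexFlipLin]; ring
  · simp [simplexFlip, simplexFlipLin, h]

/-- The linear part is an involution, so its determinant is ±1. -/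
theorem measurePreserving_simplexFlip {n : ℕ} (a : Fin n) :
    MeasurePreserving (simplexFlip a) := by
  have hdet : LinearMap.det (simplexFlipLin a) * LinearMap.det (simplexFlipLin a) = 1 := by
    rw [← LinearMap.det_comp, simplexFlipLin_comp, LinearMap.det_id]
  have hne : LinearMap.det (simplexFlipLin a) ≠ 0 := left_ne_zero_of_mul_eq_one hdet
  have habs : |(LinearMap.det (simplexFlipLin a))⁻¹| = 1 := by
    rw [abs_inv]
    rcases mul_self_eq_one_iff.1 hdet with h | h <;> simp [h]
  have h1 : MeasurePreserving (simplexFlipLin a) := by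
    refine ⟨(simplexFlipLin a).continuous_of_finiteDimensional.measurable, ?_⟩
    rw [Measure.map_linearMap_addHaar_eq_smul_addHaar volume hne, habs]
    simp
  have h2 := (measurePreserving_add_left (volume : Measure (Fin n → ℝ)) (Pi.single a 1)).comp h1
  have h3 : simplexFlip a = (fun x => Pi.single a 1 + x) ∘ simplexFlipLin a :=
    funext fun s => simplexFlip_eq a s
  rw [h3]
  exact h2

theorem simplexFlip_mem {n : ℕ} (a : Fin n) {s : Fin n → ℝ} (hs : s ∈ refSimplex n) :
    simplexFlip a s ∈ refSimplex n := by
  refine ⟨fun b => ?_, ?_⟩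
  · by_cases h : b = a
    · subst h
      simpa [simplexFlip] using hs.2
    · simpa [simplexFlip, h] using hs.1 b
  · rw [simplexFlip, sum_update]
    linarith [hs.1 a]

theorem isCompact_refSimplex (n : ℕ) : IsCompact (refSimplex n) := by
  refine Metric.isCompact_of_isClosed_isBounded ?_ ?_
  · refine IsClosed.inter (s₁ := {s : Fin n → ℝ | ∀ a, 0 ≤ s a})
      (s₂ := {s : Fin n → ℝ | ∑ a, s a ≤ 1}) ?_ ?_
    · simp only [Set.ofPred_forall]
      exact isClosed_iInter fun a => isClosed_le continuous_const (by fun_prop)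
    · exact isClosed_le (by fun_prop) continuous_const
  · refine isBounded_iff_forall_norm_le.2 ⟨1, fun s hs => ?_⟩
    refine (pi_norm_le_iff_of_nonneg zero_le_one).2 fun a => ?_
    rw [Real.norm_eq_abs, abs_of_nonneg (hs.1 a)]
    exact (Finset.single_le_sum (fun b _ => hs.1 b) (Finset.mem_univ a)).trans hs.2

/-- The integral of a barycentric coordinate over the reference simplex. -/
def refMoment (n : ℕ) : ℝ := ∫ s in refSimplex n, (1 - ∑ a, s a)

/-- The flip exchanges s a with the zeroth barycentric coordinate, so all barycentric coordinates
have the same integral. -/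
theorem integral_refSimplex_coord {n : ℕ} (a : Fin n) :
    ∫ s in refSimplex n, s a = refMoment n := by
  have hmeas : Measurable (simplexFlip a) := (measurePreserving_simplexFlip a).measurable
  let e : (Fin n → ℝ) ≃ᵐ (Fin n → ℝ) :=
    { toEquiv := (simplexFlip_involutive a).toPerm
      measurable_toFun := hmeas
      measurable_invFun := hmeas }
  have hpre : simplexFlip a ⁻¹' refSimplex n = refSimplex n := by
    ext s
    exact ⟨fun h => simplexFlip_involutive a s ▸ simplexFlip_mem a h, fun h => simplexFlip_mem a h⟩
  have h := (measurePreserving_simplexFlip a).setIntegral_preimage_emb e.measurableEmbedding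
    (fun s => s a) (refSimplex n)
  rw [hpre] at h
  rw [← h, refMoment]
  simp [simplexFlip]

theorem integrableOn_refSimplex {n : ℕ} {f : (Fin n → ℝ) → ℝ} (hf : Continuous f) :
    IntegrableOn f (refSimplex n) :=
  hf.continuousOn.integrableOn_compact (isCompact_refSimplex n)

/-- The n + 1 barycentric coordinates sum to 1, so n + 1 times the moment is the volume. The exact
value is never needed. -/
theorem refMoment_pos (n : ℕ) : 0 < refMoment n := by
  have hvol : (n + 1) * refMoment n = (volume (refSimplex n)).toReal := by
    have h1 : ∫ s in refSimplex n, ((1 - ∑ a, s a) + ∑ a, s a) =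
        refMoment n + ∑ a : Fin n, refMoment n := by
      rw [integral_add (integrableOn_refSimplex (by fun_prop))
        (integrableOn_refSimplex (by fun_prop)), integral_finsetSum]
      · simp only [integral_refSimplex_coord, refMoment]
      · exact fun a _ => integrableOn_refSimplex (by fun_prop)
    simp only [sub_add_cancel, setIntegral_const, measureReal_def, smul_eq_mul, mul_one,
      Finset.sum_const, Finset.card_univ, Fintype.card_fin, nsmul_eq_mul] at h1
    rw [h1]
    ring
  have hpos : 0 < volume (refSimplex n) := by
    have hopen : IsOpen {s : Fin n → ℝ | (∀ a, 0 < s a) ∧ ∑ a, s a < 1} := by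
      refine IsOpen.inter (s := {s : Fin n → ℝ | ∀ a, 0 < s a})
        (t := {s : Fin n → ℝ | ∑ a, s a < 1}) ?_ ?_
      · simp only [Set.ofPred_forall]
        exact isOpen_iInter_of_finite fun a => isOpen_lt continuous_const (by fun_prop)
      · exact isOpen_lt (by fun_prop) continuous_const
    refine (hopen.measure_pos volume ⟨fun _ => ((n : ℝ) + 1)⁻¹, fun _ => by positivity, ?_⟩).trans_le
      (measure_mono fun s hs => ⟨fun a => (hs.1 a).le, hs.2.le⟩)
    have : (0 : ℝ) < n + 1 := by positivity
    simp only [Finset.sum_const, Finset.card_univ, Fintype.card_fin, nsmul_eq_mul]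
    rw [← div_eq_mul_inv, div_lt_one this]
    linarith
  have h2 : 0 < (volume (refSimplex n)).toReal :=
    ENNReal.toReal_pos hpos.ne' (isCompact_refSimplex n).measure_ne_top
  rw [← hvol] at h2
  exact pos_of_mul_pos_right h2 (by positivity)

theorem param_mem {n : ℕ} (p : Fin (n + 1) → Pt n) {s : Fin n → ℝ} (hs : s ∈ refSimplex n) :
    param p s ∈ closedSimplex p := by
  refine mem_closedSimplex_iff.2 ⟨Fin.cons (1 - ∑ a, s a) s, fun a => ?_, ?_, ?_⟩
  · refine Fin.cases ?_ (fun a => ?_) a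
    · simpa using hs.2
    · simpa using hs.1 a
  · simp [Fin.sum_univ_succ]
  · simp only [param, Fin.sum_univ_succ, Fin.cons_zero, Fin.cons_succ, sub_smul, one_smul, smul_sub,
      Finset.sum_sub_distrib, Finset.sum_smul]
    abel

/-- An affine function is the combination of its vertex values with the barycentric coordinates,
which all have the same integral. -/
theorem simplexIntegral_affine {n : ℕ} (p : Fin (n + 1) → Pt n) {f : Pt n → ℝ}
    (A : Pt n →ᵃ[ℝ] ℝ) (hf : Set.EqOn f A (closedSimplex p)) :
    simplexIntegral p f = ‖areaNormal p‖ * (refMoment n * ∑ a, f (p a)) := by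
  have hvert : ∀ a, f (p a) = A (p a) := fun a =>
    hf (subset_convexHull ℝ _ (Set.mem_range_self a))
  have h1 : Set.EqOn (fun s => f (param p s))
      (fun s => (1 - ∑ a, s a) * A (p 0) + ∑ a : Fin n, s a * A (p a.succ)) (refSimplex n) := by
    intro s hs
    simp only
    have hvadd : A (param p s) = A.linear (∑ a, s a • (p a.succ - p 0)) + A (p 0) := by
      have hpar : param p s = (∑ a, s a • (p a.succ - p 0)) +ᵥ p 0 := add_comm _ _
      rw [hpar]
      exact A.map_vadd (p 0) _
    rw [hf (param_mem p hs), hvadd, map_sum]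
    have : ∀ a : Fin n, A.linear (p a.succ - p 0) = A (p a.succ) - A (p 0) := fun a =>
      A.linearMap_vsub _ _
    simp only [map_smul, this, smul_eq_mul, mul_sub, Finset.sum_sub_distrib, sub_mul,
      Finset.sum_mul]
    ring
  rw [simplexIntegral, setIntegral_congr_fun (isCompact_refSimplex n).isClosed.measurableSet h1,
    integral_add (integrableOn_refSimplex (by fun_prop)) (integrableOn_refSimplex (by fun_prop)),
    integral_finsetSum _ fun a _ => integrableOn_refSimplex (by fun_prop)]
  simp only [integral_mul_const, integral_refSimplex_coord]
  simp only [Fin.sum_univ_succ, hvert, mul_add, Finset.mul_sum, refMoment]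

/-! ### Determinants along linear motions -/

theorem continuous_vecDet (n : ℕ) : Continuous (vecDet n) := by
  have : (vecDet n : (Fin (n + 1) → Pt n) → ℝ) =
      fun p => Matrix.det (Matrix.of fun a k => p a k) := rfl
  rw [this]
  refine Continuous.matrix_det (continuous_matrix fun a k => ?_)
  simp only [Matrix.of_apply]
  fun_prop

theorem continuous_areaNormal (n : ℕ) :
    Continuous (areaNormal : (Fin (n + 1) → Pt n) → Pt n) := by
  unfold areaNormal
  refine (PiLp.continuous_toLp 2 _).comp (continuous_pi fun k => Continuous.matrix_det
    (continuous_matrix fun a l => ?_))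
  refine Fin.lastCases ?_ (fun a => ?_) a
  · simpa using continuous_const
  · simp only [Matrix.of_apply, Fin.snoc_castSucc, PiLp.sub_apply]
    fun_prop

theorem hasDerivAt_vecDet {n : ℕ} {p : ℝ → Fin (n + 1) → Pt n} {v : Fin (n + 1) → Pt n} {t : ℝ}
    (hp : ∀ a, HasDerivAt (fun t => p t a) (v a) t) :
    HasDerivAt (fun t => vecDet n (p t)) (∑ a, vecDet n (Function.update (p t) a (v a))) t := by
  let f : ContinuousMultilinearMap ℝ (fun _ : Fin (n + 1) => Pt n) ℝ :=
    ⟨(vecDet n).toMultilinearMap, continuous_vecDet n⟩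
  have h := (f.hasFDerivAt (p t)).comp_hasDerivAt t (hasDerivAt_pi.2 hp)
  rw [ContinuousMultilinearMap.linearDeriv_apply] at h
  exact h

/-- The position at time `t` of a point that moves linearly from `x` to `y` in `[t₀, t₁]`. -/
def lerp {n : ℕ} (t₀ t₁ t : ℝ) (x y : Pt n) : Pt n :=
  ((t₁ - t) / (t₁ - t₀)) • x + ((t - t₀) / (t₁ - t₀)) • y

theorem hasDerivAt_lerp {n : ℕ} (t₀ t₁ t : ℝ) (x y : Pt n) :
    HasDerivAt (fun t => lerp t₀ t₁ t x y) ((1 / (t₁ - t₀)) • (y - x)) t := by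
  have h1 : HasDerivAt (fun t : ℝ => (t₁ - t) / (t₁ - t₀)) (-1 / (t₁ - t₀)) t :=
    ((hasDerivAt_id t).const_sub t₁).div_const _
  have h2 : HasDerivAt (fun t : ℝ => (t - t₀) / (t₁ - t₀)) (1 / (t₁ - t₀)) t :=
    ((hasDerivAt_id t).sub_const t₀).div_const _
  refine ((h1.smul_const x).add (h2.smul_const y)).congr_deriv ?_
  rw [smul_sub, neg_div, neg_smul]
  abel

theorem lerp_left {n : ℕ} {t₀ t₁ : ℝ} (ht : t₀ < t₁) (x y : Pt n) : lerp t₀ t₁ t₀ x y = x := by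
  simp [lerp, (sub_pos.2 ht).ne']

theorem lerp_right {n : ℕ} {t₀ t₁ : ℝ} (ht : t₀ < t₁) (x y : Pt n) : lerp t₀ t₁ t₁ x y = y := by
  simp [lerp, (sub_pos.2 ht).ne']

theorem continuous_lerp {n : ℕ} (t₀ t₁ : ℝ) (x y : Pt n) :
    Continuous fun t => lerp t₀ t₁ t x y := by
  unfold lerp
  fun_prop

/-- The facet contribution to the transport of a moving simplex. -/
def facetFlux {n : ℕ} (P V : Pt n → Pt n) (F : Fin n → Pt n) : ℝ :=
  ∑ k, vecDet n (Matrix.vecCons (V (F k)) (P ∘ F))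

theorem facetFlux_perm {n : ℕ} (P V : Pt n → Pt n) (F : Fin n → Pt n) (π : Equiv.Perm (Fin n)) :
    facetFlux P V (F ∘ π) = ((Equiv.Perm.sign π : ℤ) : ℝ) * facetFlux P V F := by
  have h1 : ∀ v, vecDet n (Matrix.vecCons v (P ∘ F ∘ π)) =
      ((Equiv.Perm.sign π : ℤ) : ℝ) * vecDet n (Matrix.vecCons v (P ∘ F)) := fun v => by
    have h2 : ∀ G : Fin n → Pt n, vecDet n (Matrix.vecCons v G) = (vecDet n).curryLeft v G :=
      fun G => rfl
    rw [h2, h2, ← Function.comp_assoc, AlternatingMap.map_perm]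
    simp [Units.smul_def]
  rw [facetFlux, facetFlux]
  simp only [h1, Function.comp_apply]
  rw [← Finset.mul_sum]
  congr 1
  exact Equiv.sum_comp π fun k => vecDet n (Matrix.vecCons (V (F k)) (P ∘ F))

/-- The normal flux through a moving simplex is the rate of change of the signed volume of the cone
over it, up to contributions of its facets. -/
theorem sum_inner_areaNormal {n : ℕ} (P V : Pt n → Pt n) (p : Fin (n + 1) → Pt n) :
    ∑ a, inner ℝ (areaNormal (P ∘ p)) (V (p a)) =
      (-1) ^ n * (∑ b, vecDet n (Function.update (P ∘ p) b (V (p b))) +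
        ∑ b : Fin (n + 1), (-1) ^ (b : ℕ) * facetFlux P V (p ∘ b.succAbove)) := by
  simp only [inner_areaNormal_eq_sum]
  -- The sum is over the vertex a that supplies the velocity and the slot b that it replaces. The
  -- pairs a = b give the derivative of the determinant; for a ≠ b the vertex p b no longer occurs,
  -- and the term belongs to the facet opposite to it.
  rw [← Finset.mul_sum, Finset.sum_comm, ← Finset.sum_add_distrib]
  congr 1
  refine Finset.sum_congr rfl fun b _ => ?_
  rw [Fin.sum_univ_succAbove _ b, facetFlux, Finset.mul_sum]
  congr 1
  refine Finset.sum_congr rfl fun k _ => ?_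
  rw [vecDet_update]
  rfl

end Stefan

end

/-! ### Transport of the signed cone volumes. -/

noncomputable section

namespace Stefan

open Filter Topology MeasureTheory

namespace ClusterMesh

variable {n : ℕ} {M : ClusterMesh n} {Ω : Set (Pt n)} {q q' : M.Config}
  {Ph Ph' : Fin M.numPhase → Set (Pt n)}

/-- Two embedded configurations of the same cluster are related by a map of the vertices. -/
theorem exists_vertexMotion (h : M.IsCluster Ω q Ph) (h' : M.IsCluster Ω q' Ph') :
    ∃ χ : Pt n → Pt n, ∀ c, M.cell q' c = χ ∘ M.cell q c := by
  -- At both time levels, the same relation `Matched` determines which vertices coincide.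
  have hfac : Function.FactorsThrough (fun u : Σ i, Fin (M.numVert i) => q' u.1 u.2)
      (fun u => q u.1 u.2) := fun u v huv =>
    (h'.vertex_eq_iff u v).2 ((h.vertex_eq_iff u v).1 huv)
  obtain ⟨χ, hχ⟩ := (Function.factorsThrough_iff _).1 hfac
  exact ⟨χ, fun c => funext fun a => congrFun hχ ⟨c.1, M.simp c.1 c.2 a⟩⟩

/-- If the weighted normal fluxes of a linear motion of the cluster cancel, then the weighted sum of
the signed volumes of the cones over the simplices is preserved. -/
theorem IsCluster.sum_vecDet_eq_of_flux (h : M.IsCluster Ω q Ph) (hn : n ≠ 0) (hΩ : IsOpen Ω)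
    (β : Fin M.numPhase → ℝ) {t₀ t₁ : ℝ} (ht : t₀ < t₁) (χ : Pt n → Pt n)
    (hflux : ∑ c : M.Cell, M.jump β c.1 * ∑ a, inner ℝ
      (∫ t in t₀..t₁, areaNormal fun a => lerp t₀ t₁ t (M.cell q c a) (χ (M.cell q c a)))
      (χ (M.cell q c a) - M.cell q c a) = 0) :
    ∑ c : M.Cell, M.jump β c.1 * vecDet n (M.cell q c) =
      ∑ c : M.Cell, M.jump β c.1 * vecDet n (χ ∘ M.cell q c) := by
  set P : ℝ → Pt n → Pt n := fun t x => lerp t₀ t₁ t x (χ x) with hP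
  set V : Pt n → Pt n := fun x => χ x - x with hV
  set g : ℝ → ℝ := fun t => ∑ c : M.Cell, M.jump β c.1 *
    ∑ a, inner ℝ (areaNormal (P t ∘ M.cell q c)) (V (M.cell q c a)) with hg
  have hτ : t₁ - t₀ ≠ 0 := (sub_pos.2 ht).ne'
  have hNc : ∀ c, Continuous fun t => areaNormal (P t ∘ M.cell q c) := fun c =>
    (continuous_areaNormal n).comp (continuous_pi fun a => continuous_lerp _ _ _ _)
  have hgc : Continuous g :=
    continuous_finsetSum _ fun c _ => continuous_const.mul (continuous_finsetSum _ fun a _ =>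
      (hNc c).inner continuous_const)
  have hgint : ∫ t in t₀..t₁, g t = 0 := by
    rw [← hflux, hg, intervalIntegral.integral_finsetSum]
    · refine Finset.sum_congr rfl fun c _ => ?_
      rw [intervalIntegral.integral_const_mul, intervalIntegral.integral_finsetSum]
      · congr 1
        refine Finset.sum_congr rfl fun a _ => ?_
        have := (innerSL ℝ (V (M.cell q c a))).intervalIntegral_comp_comm
          ((hNc c).intervalIntegrable (μ := volume) t₀ t₁)
        simp only [innerSL_apply_apply] at this
        simp only [real_inner_comm (V (M.cell q c a))]
        exact this.trans (real_inner_comm _ _)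
      · exact fun a _ => ((hNc c).inner continuous_const).intervalIntegrable _ _
    · exact fun c _ => (continuous_const.mul (continuous_finsetSum _ fun a _ =>
        (hNc c).inner continuous_const)).intervalIntegrable _ _
  have hder : ∀ t, HasDerivAt (fun t => ∑ c : M.Cell, M.jump β c.1 * vecDet n (P t ∘ M.cell q c))
      ((-1) ^ n * (1 / (t₁ - t₀)) * g t) t := by
    intro t
    have h1 : HasDerivAt
        (fun t => ∑ c : M.Cell, M.jump β c.1 * vecDet n (P t ∘ M.cell q c))
        (∑ c : M.Cell, M.jump β c.1 * ∑ a, vecDet n (Function.update (P t ∘ M.cell q c) a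
          ((1 / (t₁ - t₀)) • V (M.cell q c a)))) t :=
      HasDerivAt.fun_sum fun c _ => (hasDerivAt_vecDet fun a =>
        hasDerivAt_lerp t₀ t₁ t (M.cell q c a) (χ (M.cell q c a))).const_mul _
    refine h1.congr_deriv ?_
    -- The positions at time t enter only through the alternating function of the old facets, so the
    -- cycle property of the old cluster suffices.
    have h2 : g t = (-1) ^ n * ∑ c : M.Cell, M.jump β c.1 *
        ∑ a, vecDet n (Function.update (P t ∘ M.cell q c) a (V (M.cell q c a))) := by
      have h3 := h.sum_facets_eq_zero hn hΩ β (Φ := facetFlux (P t) V)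
        (fun F π => facetFlux_perm (P t) V F π)
      simp only [hg, sum_inner_areaNormal]
      rw [← add_zero ((-1) ^ n * _), ← mul_zero ((-1) ^ n), ← h3, ← mul_add,
        ← Finset.sum_add_distrib, Finset.mul_sum]
      refine Finset.sum_congr rfl fun c _ => ?_
      rw [← mul_add]
      ring
    simp only [AlternatingMap.map_update_smul, smul_eq_mul, ← Finset.mul_sum]
    rw [h2]
    have hsq : ((-1 : ℝ) ^ n) * (-1) ^ n = 1 := by rw [← mul_pow]; simp
    simp only [mul_left_comm (M.jump β _) (1 / (t₁ - t₀)), ← Finset.mul_sum]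
    linear_combination -((1 / (t₁ - t₀)) * ∑ c : M.Cell, M.jump β c.1 *
      ∑ a, vecDet n (Function.update (P t ∘ M.cell q c) a (V (M.cell q c a)))) * hsq
  have hftc := intervalIntegral.integral_eq_sub_of_hasDerivAt (fun t _ => hder t)
    ((continuous_const.mul hgc).intervalIntegrable t₀ t₁)
  rw [intervalIntegral.integral_const_mul, hgint, mul_zero] at hftc
  have h0 : ∀ c, P t₀ ∘ M.cell q c = M.cell q c := fun c => funext fun a => lerp_left ht _ _
  have h1 : ∀ c, P t₁ ∘ M.cell q c = χ ∘ M.cell q c := fun c => funext fun a => lerp_right ht _ _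
  simp only [h0, h1] at hftc
  linarith

/-! ### The scheme -/

theorem lumpedIntegral_congr {q : M.Config} {i : Fin M.numSurf} {f g : Pt n → ℝ}
    (hfg : ∀ k, f (q i k) = g (q i k)) : M.lumpedIntegral q i f = M.lumpedIntegral q i g := by
  simp only [lumpedIntegral, corners, hfg]

/-- This treats both meanings of the quadrature at once: against the test function 1 the integrand
is a piecewise affine interpolant. Of the constant only its being nonzero matters. -/
theorem surfIntegral_eq_lumpedIntegral {q : M.Config} {i : Fin M.numSurf} {g : Pt n → ℝ}
    (hg : M.InSurf q i g) :
    M.surfIntegral q i g = refMoment n * ((n + 1) * n.factorial) * M.lumpedIntegral q i g := by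
  have h1 : (n : ℝ) + 1 ≠ 0 := by positivity
  have h2 : (n.factorial : ℝ) ≠ 0 := by positivity
  rw [surfIntegral, lumpedIntegral, ← mul_assoc, Finset.mul_sum]
  refine Finset.sum_congr rfl fun j _ => ?_
  obtain ⟨A, hA⟩ := hg.2 j
  rw [simplexIntegral_affine _ A hA, simplexArea]
  field_simp

theorem inSurf_displacement {q : M.Config} {i : Fin M.numSurf} {X : Pt n → Pt n}
    (hX : M.InSurf q i X) (r : ℝ) : M.InSurf q i fun x => r • (X x - x) := by
  refine ⟨(hX.1.sub continuousOn_id).const_smul r, fun j => ?_⟩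
  obtain ⟨A, hA⟩ := hX.2 j
  refine ⟨r • (A - AffineMap.id ℝ _), fun x hx => ?_⟩
  simp [hA hx]

/-- The area element cancels the norm of the normal in the definition of `midNormal`, which leaves
the plain time integral of the normals. -/
theorem simplexIntegral_inner_midNormal {t₀ t₁ : ℝ} (ht : t₀ < t₁) {p : Fin (n + 1) → Pt n}
    (p' : Fin (n + 1) → Pt n) (hp : AffineIndependent ℝ p) {ξ : Pt n → Pt n} (A : Pt n →ᵃ[ℝ] Pt n)
    (hA : Set.EqOn ξ A (closedSimplex p)) :
    simplexIntegral p (fun x => inner ℝ (midNormal t₀ t₁ p p') (ξ x)) =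
      refMoment n * (1 / (t₁ - t₀)) * ∑ a, inner ℝ
        (∫ t in t₀..t₁, areaNormal fun a => lerp t₀ t₁ t (p a) (p' a)) (ξ (p a)) := by
  have hN : ‖areaNormal p‖ ≠ 0 := norm_ne_zero_iff.2 (areaNormal_ne_zero hp)
  have hτ : t₁ - t₀ ≠ 0 := (sub_pos.2 ht).ne'
  rw [simplexIntegral_affine p ((innerₛₗ ℝ (midNormal t₀ t₁ p p')).toAffineMap.comp A)
    (fun x hx => by simp [hA hx])]
  have hmid : midNormal t₀ t₁ p p' = (1 / ((t₁ - t₀) * ‖areaNormal p‖)) •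
    ∫ t in t₀..t₁, areaNormal fun a => lerp t₀ t₁ t (p a) (p' a) := rfl
  simp only [hmid, inner_smul_left, conj_trivial, ← Finset.mul_sum]
  field_simp

theorem inBulk_const (Ω : Set (Pt n)) (T : Geometry.SimplicialComplex ℝ (Pt n)) (r : ℝ) :
    InBulk Ω T fun _ => r :=
  ⟨continuousOn_const, fun _ _ => ⟨AffineMap.const ℝ _ r, fun _ _ => rfl⟩⟩

/-- Testing the motion law with a constant shows that the weighted normal fluxes cancel. -/
theorem flux_eq_zero {T : Geometry.SimplicialComplex ℝ (Pt n)} {β : Fin M.numPhase → ℝ}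
    {tension : Fin M.numSurf → ℝ} {lumped : Bool} {t₀ t₁ : ℝ} (ht : t₀ < t₁)
    (h : M.IsCluster Ω q Ph) {W : Pt n → ℝ} {X : Fin M.numSurf → Pt n → Pt n}
    {κ : Fin M.numSurf → Pt n → ℝ} (hsol : IsSolution M Ω T β tension lumped t₀ t₁ q W X κ) :
    ∑ c : M.Cell, M.jump β c.1 * ∑ a, inner ℝ
      (∫ t in t₀..t₁, areaNormal fun a =>
        lerp t₀ t₁ t (M.cell q c a) (M.cell (M.moved q X) c a))
      (M.cell (M.moved q X) c a - M.cell q c a) = 0 := by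
  obtain ⟨ω, g, hω, hg, hmotion, -, -⟩ := hsol.equations
  have hτ : t₁ - t₀ ≠ 0 := (sub_pos.2 ht).ne'
  have hm := hmotion _ (inBulk_const Ω T 1)
  simp only [gradient_fun_const, inner_zero_right, integral_zero, zero_add, mul_one] at hm
  have hR := (refMoment_pos n).ne'
  have hlump : ∑ i, M.jump β i * M.lumpedIntegral q i (g i) = 0 := by
    cases lumped with
    | true => simpa [quadIntegral] using hm
    | false =>
      simp only [quadIntegral, Bool.false_eq_true, if_false,
        fun i => surfIntegral_eq_lumpedIntegral (hg i).1] at hm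
      simp only [mul_left_comm (M.jump β _) (refMoment n * _), ← Finset.mul_sum] at hm
      exact (mul_eq_zero.1 hm).resolve_left (mul_ne_zero hR (by positivity))
  have hi : ∀ i, M.lumpedIntegral q i (g i) = refMoment n * (1 / (t₁ - t₀)) * (1 / (t₁ - t₀)) *
      ∑ j, ∑ a, inner ℝ
        (∫ t in t₀..t₁, areaNormal fun a =>
          lerp t₀ t₁ t (M.corners q i j a) (M.corners (M.moved q X) i j a))
        (M.corners (M.moved q X) i j a - M.corners q i j a) := by
    intro i
    have hX := hsol.mem_cluster.1 i
    have hξ := inSurf_displacement hX (1 / (t₁ - t₀))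
    -- The lumped rule sees only vertex values, so the interpolant may be replaced by the product.
    -- The displacement velocity is then an admissible test field in the definition of ω.
    have hgω : M.lumpedIntegral q i (g i) = M.lumpedIntegral q i
        (fun x => inner ℝ (ω i x) ((1 / (t₁ - t₀)) • (X i x - x))) :=
      lumpedIntegral_congr fun k => ((hg i).2 k).trans (real_inner_comm _ _)
    rw [hgω, (hω i).2 _ hξ, Finset.mul_sum]
    refine Finset.sum_congr rfl fun j _ => ?_
    obtain ⟨A, hA⟩ := hξ.2 j
    rw [simplexIntegral_inner_midNormal ht _ (h.nondegenerate i j) A hA]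
    simp only [inner_smul_right, ← Finset.mul_sum]
    rw [← mul_assoc]
    rfl
  simp only [hi, mul_left_comm (M.jump β _) (refMoment n * _ * _), ← Finset.mul_sum] at hlump
  have hfin := (mul_eq_zero.1 hlump).resolve_left
    (mul_ne_zero (mul_ne_zero hR (one_div_ne_zero hτ)) (one_div_ne_zero hτ))
  rw [Fintype.sum_sigma]
  simp only [Finset.mul_sum (s := (Finset.univ : Finset (Fin (M.numSimp _))))] at hfin
  exact hfin

end ClusterMesh

end Stefan

end

theorem theorem6p1 {n : ℕ} (hn : n + 1 = 2 ∨ n + 1 = 3)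
    (M : Stefan.ClusterMesh n)
    (Ω : Set (Stefan.Pt n)) (hΩ_open : IsOpen Ω) (hΩ_conn : IsConnected Ω)
    (hΩ_bdd : Bornology.IsBounded Ω)
    (T : Geometry.SimplicialComplex ℝ (Stefan.Pt n)) (hT : Stefan.IsTriangulation Ω T)
    (β : Fin M.numPhase → ℝ) (tension : Fin M.numSurf → ℝ) (htension : ∀ i, 0 < tension i)
    (lumped : Bool) (t₀ t₁ : ℝ) (ht : t₀ < t₁)
    -- the cluster at the old time level, with its phases
    (q : M.Config) (Ph : Fin M.numPhase → Set (Stefan.Pt n)) (hq : M.IsCluster Ω q Ph)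
    -- a solution of the scheme
    (W : Stefan.Pt n → ℝ) (X : Fin M.numSurf → Stefan.Pt n → Stefan.Pt n)
    (κ : Fin M.numSurf → Stefan.Pt n → ℝ)
    (hsol : Stefan.IsSolution M Ω T β tension lumped t₀ t₁ q W X κ)
    -- the cluster at the new time level, with its phases
    (Ph' : Fin M.numPhase → Set (Stefan.Pt n)) (hq' : M.IsCluster Ω (M.moved q X) Ph')
    -- near the outer boundary, the phases are the same at both time levels
    (hbdry : ∀ x ∈ frontier Ω, ∀ ℓ, ∀ᶠ y in nhds x, y ∈ Ph ℓ ↔ y ∈ Ph' ℓ) :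
    M.energyContent β Ph' = M.energyContent β Ph := by
  have hflux := Stefan.ClusterMesh.flux_eq_zero ht hq hsol
  obtain ⟨χ, hχ⟩ := Stefan.ClusterMesh.exists_vertexMotion hq hq'
  simp only [hχ] at hflux
  have hsum := hq.sum_vecDet_eq_of_flux (by omega) hΩ_open β ht χ hflux
  have hdiff := Stefan.ClusterMesh.energyContent_sub hq hq' hbdry hΩ_open hΩ_bdd β
  simp only [hχ] at hdiff
  rw [hsum, sub_self, mul_zero, mul_zero] at hdiff
  exact sub_eq_zero.1 hdiff
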